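/- **Conventions.** Let $K$ be a field and $V=\bigoplus_{k\in\mathbb Z}V^k$ a graded vector space; for $a\in V^k$ put $|a|=k$ and $\|a\|=|a|-1$. An ordered partition $\pi=(i_1|\cdots|i_r)$, $r\ge1$, is a tuple of integers $i_l\ge 0$, called regular if all $i_l\ge1$; $d(\pi)=i_1+\dots+i_r-1$ and $\bar d(\pi)=r-1$. A collection of partitioned maps assigns to every $\pi$ an $(i_1+\dots+i_r)$-linear map $m(\pi)$ on $V$ with values in $V$, evaluated on barred strings $(a^{(1)}|\cdots|a^{(r)})$, where $a^{(l)}$ is a string of $i_l$ elements. With $n=i_1+\dots+i_r$ put $\tilde m(\pi)(a_1,\dots,a_n)=(-1)^{\sum_i(n-i)\|a_i\|}\,m(\pi)(a_1,\dots,a_n)$. All signs $\pm$ in (a) and (b) below are Koszul signs in which an element $a$ has degree $\|a\|$, each bar has degree $1$ and the map $\tilde m$ has degree $1$. For a barred string $L=(a^{(1)}|\cdots|a^{(t)})$ let: (a) $\{\tilde m\}\{\tilde m\}(L)$ be the sum, over all nonempty sets of consecutive slots $p,\dots,q$ and all subdivisions $a^{(l)}=b^{(l)}c^{(l)}d^{(l)}$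 ($p\le l\le q$) with every $c^{(l)}$ nonempty, and over all shuffles $b$ of $b^{(p)},\dots,b^{(q)}$ and $d$ of $d^{(p)},\dots,d^{(q)}$, of $$\pm\,\tilde m\bigl(a^{(1)}|\cdots|a^{(p-1)}\,|\,b,\ \tilde m(c^{(p)}|\cdots|c^{(q)}),\ d\,|\,a^{(q+1)}|\cdots|a^{(t)}\bigr);$$ (b) $F(\tilde m)(L)$ be the sum, over $1\le\alpha<t$ and all shuffles $w$ of $a^{(\alpha)}$ and $a^{(\alpha+1)}$, of $\pm\tilde m(a^{(1)}|\cdots|a^{(\alpha-1)}|w|a^{(\alpha+2)}|\cdots|a^{(t)})$, where the sign is $(-1)^e$ times the Koszul sign of the shuffle and $e$ is the total degree of everything to the left of the removed bar. A **$G_\infty$ algebra** is a graded vector space $V$ with partitioned maps $m(\pi)$, homogeneous of degrees $|m(\pi)|\equiv d(\pi)+\bar d(\pi)+1 \pmod 2$, such that $m(1|0)=m(0|1)=\mathrm{id}$, all other $m(\pi)$ with a zero slot vanish, and $$\{\tilde m\}\{\tilde m\}(L)+F(\tilde m)(L)=0$$ for every barred string $L$ of homogeneous elements whose type is a regular partition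 $\pi$ with $m(\pi)\not\equiv0$. **Hochschild complex.** Let $A=\bigoplus_{k\in\mathbb Z}A^k$ be a graded associative (not necessarily unital) $K$-algebra with multiplication $m$; an ungraded algebra is the case $A=A^0$. Let $\bar C^\bullet(A)=\bigoplus_{n\ge1}\operatorname{Hom}(A^{\otimes n};A)$, where $\operatorname{Hom}(A^{\otimes n};A)$ is the direct sum over $s\in\mathbb Z$ of the spaces of $n$-linear maps of degree $s$. An $n$-linear map $x$ of degree $s$ has bidegree $d(x)=n-1$, $|x|=s$, and has degree $n+s$ in $\bar C^\bullet(A)$; elements $a$ of $A$ have $d(a)=-1$. The brace $\{x\}\{y_1,\dots,y_n\}$ is the map whose value on $(a_1,\dots,a_N)$ is the sum of all substitutions of $y_1,\dots,y_n,a_1,\dots,a_N$ into $x$, with the $a_i$ also substituted into the $y_j$, that retain the order of the $y_j$ and the order of the $a_i$, each with a sign $(-1)^{d(u)d(v)+|u||v|}$ for each interchange of symbols $u,v$. Put $[x,y]=\{x\}\{y\}-(-1)^{d(x)d(y)+|x||y|}\{y\}\{x\}$, and, for homogeneous cochains $x_1,\dots,x_k$, $\varepsilon(x_1,\dots,x_k)=\sum_{i<j}\bigl(d(x_i)+|x_i|+|x_i|d(x_j)\bigr)$.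 **Proposition (Gerstenhaber–Voronov–Getzler–Jones).** The truncated Hochschild complex $\bar C^\bullet(A)$ is a $G_\infty$ algebra with the structure maps $$M(1)(x)=[m,x],\qquad M(2)(x,y)=(-1)^{\varepsilon(x,y)}\{m\}\{x,y\},$$ $$M(1|n)(x,y_1,\dots,y_n)=(-1)^{\varepsilon(x,y_1,\dots,y_n)+d(x)+|x|}\,\{x\}\{y_1,\dots,y_n\}\qquad(n\ge1),$$ $M(1|0)=M(0|1)=\mathrm{id}$, and all other $M(\pi)=0$. -/

import Mathlib

open scoped DirectSum

noncomputable section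

namespace GInfinity

/-! ### Words of homogeneous elements and Koszul signs

A letter `(k, a) : ℤ × V` is an element `a` together with a super degree `|a| = k` of it.  In signs
a letter counts with its total degree `‖a‖ = |a| + d(a) = |a| - 1`, and each bar of a barred string
`(a⁽¹⁾ | ... | a⁽ᵗ⁾)` counts as a symbol of degree `1`. -/

/-- The total degree `‖w‖ = ∑ (|a| - 1)` of a word of letters. -/
def wordDeg {V : Type*} (w : List (ℤ × V)) : ℤ := (w.map fun a => a.1 - 1).sum

/-- `∑ᵢ (n - i) ‖aᵢ‖` for a word `a₁ ... aₙ`. -/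
def tildeExp {V : Type*} : List (ℤ × V) → ℤ
  | [] => 0
  | a :: w => (w.length : ℤ) * (a.1 - 1) + tildeExp w

/-- All shuffles of two words (permutations of `u v` that keep the order within `u` and within
`v`), each with the exponent of its Koszul sign. -/
def shuffle {V : Type*} : List (ℤ × V) → List (ℤ × V) → List (ℤ × List (ℤ × V))
  | [], v => [(0, v)]
  | u, [] => [(0, u)]
  | a :: u, b :: v =>
    (shuffle u (b :: v)).map (fun t => (t.1, a :: t.2)) ++
      (shuffle (a :: u) v).map (fun t => (t.1 + (b.1 - 1) * wordDeg (a :: u), b :: t.2))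
termination_by u v => u.length + v.length

/-- All shuffles of finitely many words, each with the exponent of its Koszul sign. -/
def shuffles {V : Type*} : List (List (ℤ × V)) → List (ℤ × List (ℤ × V))
  | [] => [(0, [])]
  | u :: us => (shuffles us).flatMap fun t =>
      (shuffle u t.2).map fun t' => (t.1 + t'.1, t'.2)

/-- All ways `(b, c, d)` to write a list as `b ++ c ++ d` with `c` nonempty. -/
def cuts {α : Type*} (l : List α) : List (List α × List α × List α) :=
  (List.range l.length).flatMap fun i =>
    (List.range (l.length - i)).map fun j =>
      (l.take i, (l.drop i).take (j + 1), (l.drop i).drop (j + 1))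

/-- The exponent of the Koszul sign of the rearrangement
`b₁ c₁ d₁ | ... | bₛ cₛ dₛ  ↦  (b₁ ... bₛ) (c₁ | ... | cₛ) (d₁ ... dₛ)`. -/
def extractExp {V : Type*} :
    List (List (ℤ × V) × List (ℤ × V) × List (ℤ × V)) → ℤ
  | [] => 0
  | t :: S =>
    (S.map fun t' => wordDeg t'.1 * (wordDeg t.2.1 + wordDeg t.2.2 + 1) +
      wordDeg t.2.2 * (wordDeg t'.2.1 + 1)).sum + extractExp S

/-! ### Partitioned multilinear maps and the master identity

An ordered partition `(i₁ | ... | iᵣ)` is the list `[i₁, ..., iᵣ]`. -/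

/-- A collection `m(π)` of partitioned multilinear maps: `m(i₁ | ... | iᵣ)` is an
`(i₁ + ... + iᵣ)`-linear map. -/
abbrev PartitionedMaps (K V : Type*) [Semiring K] [AddCommMonoid V] [Module K V] :=
  ∀ π : List ℕ, MultilinearMap K (fun _ : Fin π.sum => V) V

section Master

variable {K V : Type*} [Field K] [AddCommGroup V] [Module K V]

/-- `{m(i₁ | ... | iᵣ)}{a⁽¹⁾ | ... | a⁽ʳ⁾}`, where `iₗ` is the length of `a⁽ˡ⁾`. -/
def PartitionedMaps.apply (m : PartitionedMaps K V) (L : List (List V)) : V :=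
  m (L.map List.length) fun i => L.flatten.get (i.cast List.length_flatten.symm)

/-- The sign-modified maps `m̃`, as letters: for a word with `n` arguments in all,
`m̃(a⁽¹⁾ | ... | a⁽ʳ⁾) = (-1)^(∑ (n - i) ‖aᵢ‖) m(a⁽¹⁾ | ... | a⁽ʳ⁾)`, and this has super degree
`∑ |aᵢ| + |m(π)|`; here `s π = |m(π)|`. -/
def PartitionedMaps.tilde (m : PartitionedMaps K V) (s : List ℕ → ℤ)
    (L : List (List (ℤ × V))) : ℤ × V :=
  ((L.flatten.map Prod.fst).sum + s (L.map List.length),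
    (tildeExp L.flatten).negOnePow • m.apply (L.map (List.map Prod.snd)))

/-- The value of the composition `{m̃}{m̃}` of regular partitioned maps on a barred string: the sum
over all ways of choosing consecutive slots `Q` of the string and subdividing each of them as
`b, c, d` with `c` nonempty; the strings `c` become the slots of the inner map, and all shuffles of
the `b`'s, the inner map, and all shuffles of the `d`'s go in this order into one slot of the
outer map. -/
def PartitionedMaps.composition (m : PartitionedMaps K V) (s : List ℕ → ℤ)
    (L : List (List (ℤ × V))) : V :=
  ((cuts L).map fun (P, Q, R) =>
    ((Q.map cuts).sections.map fun S =>
      ((shuffles (S.map fun t => t.1)).map fun b =>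
        ((shuffles (S.map fun t => t.2.2)).map fun d =>
          ((wordDeg P.flatten + P.length) + wordDeg (S.map fun t => t.1).flatten +
              extractExp S + b.1 + d.1).negOnePow •
            (m.tilde s (P ++ [b.2 ++ m.tilde s (S.map fun t => t.2.1) :: d.2] ++ R)).2).sum
        ).sum).sum).sum

/-- The value of `F(m̃)` on a barred string: the sum over all bars of the terms in which this bar
(a symbol of degree `1`) is removed and the two adjacent slots are shuffled into one. -/
def PartitionedMaps.intertwine (m : PartitionedMaps K V) (s : List ℕ → ℤ)
    (L : List (List (ℤ × V))) : V :=
  ((cuts L).map fun (P, Q, R) =>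
    match Q with
    | [u, v] =>
      ((shuffle u v).map fun w =>
        ((wordDeg P.flatten + P.length) + wordDeg u + w.1).negOnePow •
          (m.tilde s (P ++ [w.2] ++ R)).2).sum
    | _ => 0).sum

/-- `(V, m)` is a homotopy Gerstenhaber algebra: `V` is a graded vector space, `m(π)` is homogeneous
of a super degree `|m(π)| ≡ d(π) + d̄(π) + 1 (mod 2)`, where `d(i₁ | ... | iᵣ) = i₁ + ... + iᵣ - 1`
and `d̄(i₁ | ... | iᵣ) = r - 1`, the maps `m(1|0)` and `m(0|1)` are the identity and the other maps
whose partition has a zero slot vanish, and the component of the master identity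
`{m̃}{m̃} + F(m̃) = 0` of type `π` holds for each regular partition `π` such that `m(π)` is not
identically zero. -/
structure IsGInfinityAlgebra (𝒱 : ℤ → Submodule K V) (m : PartitionedMaps K V) : Prop where
  isInternal : DirectSum.IsInternal 𝒱
  one_zero : ∀ v : V, m.apply [[v], []] = v
  zero_one : ∀ v : V, m.apply [[], [v]] = v
  eq_zero : ∀ π : List ℕ, 0 ∈ π → π ≠ [1, 0] → π ≠ [0, 1] → m π = 0
  master : ∃ s : List ℕ → ℤ,
    (∀ π : List ℕ, π ≠ [] → s π ≡ ((π.sum : ℤ) - 1) + ((π.length : ℤ) - 1) + 1 [ZMOD 2]) ∧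
    (∀ (π : List ℕ) (k : Fin π.sum → ℤ) (a : Fin π.sum → V), π ≠ [] → (∀ i, a i ∈ 𝒱 (k i)) →
      m π a ∈ 𝒱 (∑ i, k i + s π)) ∧
    (∀ L : List (List (ℤ × V)), L ≠ [] → (∀ u ∈ L, u ≠ []) →
      (∀ u ∈ L, ∀ a ∈ u, a.2 ∈ 𝒱 a.1) → m (L.map List.length) ≠ 0 →
      m.composition s L + m.intertwine s L = 0)

end Master

/-! ### The truncated Hochschild complex and its braces -/

section Hochschild

variable {K A : Type*} [Field K] [NonUnitalRing A] [Module K A] (𝒜 : ℤ → Submodule K A)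

/-- `Hom^s(A^{⊗(d+1)}; A)`: the `(d+1)`-linear maps on `A` of super degree `s`, indexed by their
bidegree `(d, s)`. -/
def HomBi (p : ℕ × ℤ) : Submodule K (MultilinearMap K (fun _ : Fin (p.1 + 1) => A) A) where
  carrier := {x | ∀ (k : Fin (p.1 + 1) → ℤ) (a : Fin (p.1 + 1) → A),
    (∀ i, a i ∈ 𝒜 (k i)) → x a ∈ 𝒜 (∑ i, k i + p.2)}
  add_mem' hx hy k a ha := Submodule.add_mem _ (hx k a ha) (hy k a ha)
  zero_mem' _ _ _ := Submodule.zero_mem _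
  smul_mem' c _ hx k a ha := Submodule.smul_mem _ c (hx k a ha)

/-- The truncated Hochschild complex `⊕_{n ≥ 1} Hom(A^{⊗n}; A)` of the graded space `A`. -/
abbrev TruncatedHochschild := ⨁ p : ℕ × ℤ, HomBi 𝒜 p

/-- The super grading of the truncated Hochschild complex: an `n`-linear map of super degree `s` on
`A` has degree `n + s`. -/
def hochGrading (N : ℤ) : Submodule K (TruncatedHochschild 𝒜) where
  carrier := {x | ∀ p : ℕ × ℤ, (p.1 : ℤ) + 1 + p.2 ≠ N → x p = 0}
  add_mem' hx hy p hp := by simp [hx p hp, hy p hp]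
  zero_mem' _ _ := rfl
  smul_mem' c x hx p hp := by
    rw [DirectSum.smul_apply, hx p hp, smul_zero]

/-- A homogeneous cochain: a bidegree and a map of that bidegree. -/
abbrev Cochain := Σ p : ℕ × ℤ, HomBi 𝒜 p

variable {𝒜}

/-- The bidegree of a list of cochains (the sum of the bidegrees). -/
def bideg (ys : List (Cochain 𝒜)) : ℕ × ℤ := (ys.map Sigma.fst).sum

/-- The value of an `n`-linear map on a word of `n` arguments. -/
def evalList {n : ℕ} (x : MultilinearMap K (fun _ : Fin n => A) A) (l : List A) : A :=
  if h : l.length = n then x fun i => l.get (i.cast h.symm) else 0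

variable (𝒜) in
/-- `a ↦ (-1)^(p.1 * d(a) + p.2 * |a|) a` with `d(a) = -1`: the sign of the interchange of a symbol
of bidegree `p` with `a`. -/
def pass [DirectSum.Decomposition 𝒜] (p : ℕ × ℤ) : A →ₗ[K] A :=
  DirectSum.toModule K ℤ A
      (fun i => (((p.1 : ℤ) * (-1) + p.2 * i).negOnePow : ℤ) • (𝒜 i).subtype) ∘ₗ
    (DirectSum.decomposeLinearEquiv 𝒜).toLinearMap

/-- All words that are obtained from a word of elements of `A` by substituting the elements into the
cochains `y₁, ..., yₙ` in all possible ways that retain the order of the cochains and of the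
elements.  Each element carries the signs of its interchanges with the cochains that end up to the
right of its place. -/
def substitutions [DirectSum.Decomposition 𝒜] : List (Cochain 𝒜) → List A → List (List A)
  | [], l => [l]
  | _ :: _, [] => []
  | y :: ys, a :: l =>
    (substitutions (y :: ys) l).map (fun w => pass 𝒜 (bideg (y :: ys)) a :: w) ++
      if y.1.1 ≤ l.length then
        (substitutions ys (l.drop y.1.1)).map fun w =>
          evalList y.2.1 (((a :: l).take (y.1.1 + 1)).map (pass 𝒜 (bideg ys))) :: w
      else []
termination_by _ l => l.length

/-- The value of the brace `{x}{y₁, ..., yₙ}` on a word of elements of `A`. -/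
def braceFun [DirectSum.Decomposition 𝒜] (x : Cochain 𝒜) (ys : List (Cochain 𝒜)) (l : List A) : A :=
  ((substitutions ys l).map (evalList x.2.1)).sum

/-! ### Multilinearity and homogeneity of the braces -/

/-- A function of words that is linear in each letter. -/
def IsMultilinear (K : Type*) {A B : Type*} [Field K] [AddCommGroup A] [Module K A]
    [AddCommGroup B] [Module K B] (φ : List A → B) : Prop :=
  ∀ l₁ l₂ : List A, IsLinearMap K fun a => φ (l₁ ++ a :: l₂)

theorem isLinearMap_list_sum {K A B ι : Type*} [Field K] [AddCommGroup A] [Module K A]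
    [AddCommGroup B] [Module K B] (L : List ι) (f : ι → A → B)
    (hf : ∀ i ∈ L, IsLinearMap K (f i)) :
    IsLinearMap K fun a => (L.map fun i => f i a).sum := by
  induction L with
  | nil => exact ⟨by simp, by simp⟩
  | cons i L ih =>
    have h₁ := hf i (by simp)
    have h₂ := ih fun j hj => hf j (by simp [hj])
    refine ⟨fun a b => ?_, fun c a => ?_⟩
    · simp only [List.map_cons, List.sum_cons, h₁.map_add, h₂.map_add]
      abel
    · simp only [List.map_cons, List.sum_cons, h₁.map_smul, h₂.map_smul, smul_add]

theorem isLinearMap_comp {K A B C : Type*} [Field K] [AddCommGroup A] [Module K A]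
    [AddCommGroup B] [Module K B] [AddCommGroup C] [Module K C] (f : B → C) (g : A → B)
    (hf : IsLinearMap K f) (hg : IsLinearMap K g) : IsLinearMap K fun a => f (g a) :=
  (IsLinearMap.mk' f hf ∘ₗ IsLinearMap.mk' g hg).isLinear

theorem isLinearMap_add {K A B : Type*} [Field K] [AddCommGroup A] [Module K A]
    [AddCommGroup B] [Module K B] (f g : A → B)
    (hf : IsLinearMap K f) (hg : IsLinearMap K g) : IsLinearMap K fun a => f a + g a :=
  (IsLinearMap.mk' f hf + IsLinearMap.mk' g hg).isLinear

theorem ofFn_update {α : Type*} {n : ℕ} (f : Fin n → α) (i : Fin n) (v : α) :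
    List.ofFn (Function.update f i v) =
      (List.ofFn f).take i ++ v :: (List.ofFn f).drop (i + 1) := by
  have h : List.ofFn (Function.update f i v) = (List.ofFn f).set i v := by
    apply List.ext_getElem
    · simp
    · intro j h₁ h₂
      simp only [List.getElem_ofFn, List.getElem_set, Function.update_apply, Fin.ext_iff]
      simp only [eq_comm]
  rw [h, List.set_eq_take_append_cons_drop, if_pos (by simp)]

theorem evalList_isMultilinear {n : ℕ} (x : MultilinearMap K (fun _ : Fin n => A) A) :
    IsMultilinear K (evalList x) := by
  intro l₁ l₂
  by_cases h : (l₁ ++ (0 : A) :: l₂).length = n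
  · have hi : l₁.length < n := by simp at h; omega
    have key : ∀ a, evalList x (l₁ ++ a :: l₂) =
        x (Function.update (fun i => (l₁ ++ (0 : A) :: l₂).get (i.cast h.symm))
          ⟨l₁.length, hi⟩ a) := by
      intro a
      have h' : (l₁ ++ a :: l₂).length = n := by simpa using h
      rw [evalList, dif_pos h']
      congr 1
      ext j
      simp only [Function.update_apply, List.get_eq_getElem, Fin.ext_iff, Fin.val_cast,
        List.getElem_append, List.getElem_cons]
      split_ifs <;> first | rfl | omega
    refine ⟨fun a b => ?_, fun c a => ?_⟩
    · simp only [key, MultilinearMap.map_update_add]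
    · simp only [key, MultilinearMap.map_update_smul]
  · have key : ∀ a, evalList x (l₁ ++ a :: l₂) = 0 := fun a => by
      rw [evalList, dif_neg (by simpa using h)]
    refine ⟨fun a b => ?_, fun c a => ?_⟩
    · simp only [key, add_zero]
    · simp only [key, smul_zero]

theorem IsMultilinear.cons {B : Type*} [AddCommGroup B] [Module K B] {φ : List A → B}
    (h : IsMultilinear K φ) (a : A) : IsMultilinear K fun l => φ (a :: l) :=
  fun l₁ l₂ => h (a :: l₁) l₂

section Braces

set_option linter.unusedSectionVars false

variable [DirectSum.Decomposition 𝒜]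

theorem sum_substitutions_cons {B : Type*} [AddCommGroup B] (φ : List A → B)
    (y : Cochain 𝒜) (ys : List (Cochain 𝒜)) (a : A) (l : List A) :
    ((substitutions (y :: ys) (a :: l)).map φ).sum =
      ((substitutions (y :: ys) l).map fun w => φ (pass 𝒜 (bideg (y :: ys)) a :: w)).sum +
      if y.1.1 ≤ l.length then
        ((substitutions ys (l.drop y.1.1)).map fun w => φ
          (evalList y.2.1 (((a :: l).take (y.1.1 + 1)).map (pass 𝒜 (bideg ys))) :: w)).sum
      else 0 := by
  rw [substitutions]
  split_ifs <;> simp [Function.comp_def]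

theorem sum_substitutions_isLinearMap {B : Type*} [AddCommGroup B] [Module K B] (n : ℕ) :
    ∀ (ys : List (Cochain 𝒜)) (φ : List A → B), IsMultilinear K φ →
      ∀ l₁ l₂ : List A, l₁.length = n →
        IsLinearMap K fun a => ((substitutions ys (l₁ ++ a :: l₂)).map φ).sum := by
  induction n using Nat.strong_induction_on with
  | _ n ih =>
  intro ys φ hφ l₁ l₂ hn
  have hzero : IsLinearMap K fun _ : A => (0 : B) := (0 : A →ₗ[K] B).isLinear
  rcases ys with _ | ⟨y, ys⟩
  · simpa [substitutions] using hφ l₁ l₂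
  rcases l₁ with _ | ⟨x, l₁⟩
  · simp only [List.nil_append, sum_substitutions_cons]
    refine isLinearMap_add _ _ (isLinearMap_list_sum _ _ fun w _ => ?_) ?_
    · exact isLinearMap_comp (fun a => φ (a :: w)) _ (hφ [] w)
        (pass 𝒜 (bideg (y :: ys))).isLinear
    · split_ifs
      · refine isLinearMap_list_sum _ _ fun w _ => ?_
        simp only [List.take_succ_cons, List.map_cons]
        exact isLinearMap_comp (fun a => φ (a :: w)) _ (hφ [] w)
          (isLinearMap_comp (fun a => evalList y.2.1 (a :: _)) _
            (evalList_isMultilinear y.2.1 [] _) (pass 𝒜 (bideg ys)).isLinear)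
      · exact hzero
  · simp only [List.length_cons] at hn
    simp only [List.cons_append, sum_substitutions_cons]
    refine isLinearMap_add _ _ (ih l₁.length (by omega) _ _ (hφ.cons _) l₁ l₂ rfl) ?_
    simp only [List.length_append, List.length_cons]
    split_ifs
    · rcases Nat.lt_or_ge l₁.length y.1.1 with h | h
      · obtain ⟨e, he⟩ : ∃ e, y.1.1 = l₁.length + (e + 1) := ⟨y.1.1 - l₁.length - 1, by omega⟩
        simp only [he, List.take_succ_cons, List.take_append, List.drop_append,
          Nat.add_sub_cancel_left, List.drop_succ_cons, List.map_cons, List.map_append]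
        refine isLinearMap_list_sum _ _ fun w _ => ?_
        exact isLinearMap_comp (fun a => φ (a :: w)) _ (hφ [] w)
          (isLinearMap_comp (fun a => evalList y.2.1 (_ :: (_ ++ a :: _))) _
            (evalList_isMultilinear y.2.1 (_ :: _) _) (pass 𝒜 (bideg ys)).isLinear)
      · have h₁ : ∀ a, (l₁ ++ a :: l₂).drop y.1.1 = l₁.drop y.1.1 ++ a :: l₂ := fun a => by
          rw [List.drop_append_of_le_length h]
        have h₂ : ∀ a, (l₁ ++ a :: l₂).take y.1.1 = l₁.take y.1.1 := fun a => by
          rw [List.take_append_of_le_length h]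
        simp only [h₁, List.take_succ_cons, h₂]
        exact ih (l₁.drop y.1.1).length (by simp; omega) _ _ (hφ.cons _) _ l₂ rfl
    · exact hzero

theorem braceFun_isMultilinear (x : Cochain 𝒜) (ys : List (Cochain 𝒜)) :
    IsMultilinear K (braceFun x ys) := fun l₁ l₂ =>
  sum_substitutions_isLinearMap l₁.length ys _ (evalList_isMultilinear x.2.1) l₁ l₂ rfl

theorem evalList_mem (y : Cochain 𝒜) (l : List A) (ks : List ℤ)
    (h : List.Forall₂ (fun a k => a ∈ 𝒜 k) l ks) : evalList y.2.1 l ∈ 𝒜 (ks.sum + y.1.2) := by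
  rw [evalList]
  split_ifs with hl
  · have hk : ks.length = y.1.1 + 1 := h.length_eq ▸ hl
    have := y.2.2 (fun i => ks.get (i.cast hk.symm)) (fun i => l.get (i.cast hl.symm))
      fun i => List.Forall₂.get h _ _
    have e : ∑ i : Fin (y.1.1 + 1), ks.get (i.cast hk.symm) = ks.sum := by
      rw [← List.sum_ofFn]
      congr 1
      apply List.ext_getElem <;> simp [hk, -List.ofFn_succ]
    rwa [e] at this
  · exact Submodule.zero_mem _

theorem pass_mem (p : ℕ × ℤ) {a : A} {k : ℤ} (h : a ∈ 𝒜 k) : pass 𝒜 p a ∈ 𝒜 k := by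
  rw [pass, LinearMap.comp_apply, LinearEquiv.coe_coe, DirectSum.decomposeLinearEquiv_apply,
    DirectSum.decompose_of_mem _ h]
  erw [DirectSum.toModule_lof]
  exact zsmul_mem h _

theorem substitutions_mem (n : ℕ) : ∀ (ys : List (Cochain 𝒜)) (l : List A) (ks : List ℤ),
    l.length = n → List.Forall₂ (fun a k => a ∈ 𝒜 k) l ks → ∀ w ∈ substitutions ys l,
      ∃ ks' : List ℤ, List.Forall₂ (fun a k => a ∈ 𝒜 k) w ks' ∧
        ks'.sum = ks.sum + (bideg ys).2 := by
  induction n using Nat.strong_induction_on with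
  | _ n ih =>
  intro ys l ks hn h w hw
  rcases ys with _ | ⟨y, ys⟩
  · simp only [substitutions, List.mem_singleton] at hw
    exact ⟨ks, hw ▸ h, by simp [bideg]⟩
  rcases h with _ | ⟨ha, hl⟩
  · simp [substitutions] at hw
  rename_i a k l ks
  simp only [List.length_cons] at hn
  rw [substitutions, List.mem_append] at hw
  rcases hw with hw | hw
  · obtain ⟨w, hw', rfl⟩ := List.mem_map.1 hw
    obtain ⟨ks', h₁, h₂⟩ := ih l.length (by omega) _ _ _ rfl hl w hw'
    exact ⟨k :: ks', .cons (pass_mem _ ha) h₁, by simp only [List.sum_cons, h₂]; ring⟩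
  · split_ifs at hw with hd
    · obtain ⟨w, hw', rfl⟩ := List.mem_map.1 hw
      obtain ⟨ks', h₁, h₂⟩ := ih (l.drop y.1.1).length (by simp; omega) _ _ (ks.drop y.1.1) rfl
        (List.forall₂_drop _ hl) w hw'
      refine ⟨(((k :: ks).take (y.1.1 + 1)).sum + y.1.2) :: ks', .cons ?_ h₁, ?_⟩
      · refine evalList_mem y _ _ ?_
        rw [List.forall₂_map_left_iff]
        have h' : List.Forall₂ (fun a k => a ∈ 𝒜 k) (a :: l) (k :: ks) := .cons ha hl
        exact (List.forall₂_take _ h').imp fun a k h => pass_mem _ h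
      · have := List.sum_take_add_sum_drop ks y.1.1
        simp only [List.take_succ_cons, List.sum_cons, h₂, bideg, List.map_cons, Prod.snd_add]
        linarith
    · simp at hw

/-- The brace `{x}{y₁, ..., yₙ}` of homogeneous cochains, as a multilinear map. -/
def braceMap (x : Cochain 𝒜) (ys : List (Cochain 𝒜)) (n : ℕ) :
    MultilinearMap K (fun _ : Fin n => A) A :=
  MultilinearMap.mk' (fun a => braceFun x ys (List.ofFn a))
    (fun a i u v => by
      simp only [ofFn_update]; exact (braceFun_isMultilinear x ys _ _).map_add u v)
    (fun a i c u => by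
      simp only [ofFn_update]; exact (braceFun_isMultilinear x ys _ _).map_smul c u)

theorem braceMap_mem (x : Cochain 𝒜) (ys : List (Cochain 𝒜)) :
    braceMap x ys ((x.1 + bideg ys).1 + 1) ∈ HomBi 𝒜 (x.1 + bideg ys) := by
  intro k a h
  have hf : List.Forall₂ (fun a k => a ∈ 𝒜 k) (List.ofFn a) (List.ofFn k) :=
    List.forall₂_iff_get.2 ⟨by simp, fun i h₁ h₂ => by
      simpa [-List.ofFn_succ] using h _⟩
  have hk : (List.ofFn k).sum = ∑ i, k i := List.sum_ofFn
  refine list_sum_mem fun v hv => ?_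
  obtain ⟨w, hw, rfl⟩ := List.mem_map.1 hv
  obtain ⟨ks', h₁, h₂⟩ := substitutions_mem _ ys _ _ rfl hf w hw
  have := evalList_mem x w ks' h₁
  rwa [h₂, hk, show ∑ i, k i + (bideg ys).2 + x.1.2 = ∑ i, k i + (x.1 + bideg ys).2 by
    rw [Prod.snd_add]; ring] at this

/-- The brace `{x}{y₁, ..., yₙ}` of homogeneous cochains; the bidegrees add up. -/
def brace (x : Cochain 𝒜) (ys : List (Cochain 𝒜)) : TruncatedHochschild 𝒜 :=
  DirectSum.lof K (ℕ × ℤ) (fun p => HomBi 𝒜 p) (x.1 + bideg ys) ⟨_, braceMap_mem x ys⟩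

/-- The Gerstenhaber bracket `[x, y] = {x}{y} - (-1)^(d(x) d(y) + |x| |y|) {y}{x}` of homogeneous
cochains. -/
def gerstenhaberBracket (x y : Cochain 𝒜) : TruncatedHochschild 𝒜 :=
  brace x [y] - ((x.1.1 : ℤ) * y.1.1 + x.1.2 * y.1.2).negOnePow • brace y [x]

/-- A function of words of homogeneous cochains that is linear in each of them. -/
def IsMultilinearOnCochains {B : Type*} [AddCommGroup B] [Module K B]
    (Φ : List (Cochain 𝒜) → B) : Prop :=
  ∀ (l₁ l₂ : List (Cochain 𝒜)) (p : ℕ × ℤ),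
    IsLinearMap K fun w : HomBi 𝒜 p => Φ (l₁ ++ ⟨p, w⟩ :: l₂)

theorem evalList_isLinearMap (p : ℕ × ℤ) (l : List A) :
    IsLinearMap K fun w : HomBi 𝒜 p => evalList w.1 l := by
  refine ⟨fun a b => ?_, fun c a => ?_⟩ <;> simp only [evalList] <;> split_ifs <;> simp

theorem bideg_append (l₁ l₂ : List (Cochain 𝒜)) (y : Cochain 𝒜) :
    bideg (l₁ ++ y :: l₂) = bideg l₁ + (y.1 + bideg l₂) := by simp [bideg]

theorem bideg_cons (l : List (Cochain 𝒜)) (y : Cochain 𝒜) :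
    bideg (y :: l) = y.1 + bideg l := by simp [bideg]

theorem sum_substitutions_isLinearMap_cochain {B : Type*} [AddCommGroup B] [Module K B] (n : ℕ) :
    ∀ (l : List A) (φ : List A → B), IsMultilinear K φ → l.length = n →
      ∀ (ys₁ ys₂ : List (Cochain 𝒜)) (p : ℕ × ℤ),
        IsLinearMap K fun w : HomBi 𝒜 p =>
          ((substitutions (ys₁ ++ ⟨p, w⟩ :: ys₂) l).map φ).sum := by
  induction n using Nat.strong_induction_on with
  | _ n ih =>
  intro l φ hφ hn ys₁ ys₂ p
  have hzero : IsLinearMap K fun _ : HomBi 𝒜 p => (0 : B) := (0 : HomBi 𝒜 p →ₗ[K] B).isLinear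
  rcases l with _ | ⟨a, l⟩
  · rcases ys₁ with _ | ⟨y, ys₁⟩ <;> simpa [substitutions] using hzero
  simp only [List.length_cons] at hn
  rcases ys₁ with _ | ⟨y, ys₁⟩
  · simp only [List.nil_append, sum_substitutions_cons, bideg_cons]
    refine isLinearMap_add _ _ (ih l.length (by omega) l _ (hφ.cons _) rfl [] ys₂ p) ?_
    split_ifs
    · refine isLinearMap_list_sum _ _ fun w _ => ?_
      exact isLinearMap_comp (fun a => φ (a :: w)) _ (hφ [] w) (evalList_isLinearMap p _)
    · exact hzero
  · simp only [List.cons_append, sum_substitutions_cons, bideg_cons, bideg_append]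
    have := ih l.length (by omega) l _ (hφ.cons (pass 𝒜 (y.1 + (bideg ys₁ + (p + bideg ys₂))) a))
      rfl (y :: ys₁) ys₂ p
    refine isLinearMap_add _ _ this ?_
    split_ifs
    · exact ih (l.drop y.1.1).length (by simp; omega) _ _ (hφ.cons _) rfl ys₁ ys₂ p
    · exact hzero

theorem brace_eq (x : Cochain 𝒜) (ys : List (Cochain 𝒜)) (q : ℕ × ℤ) (h : x.1 + bideg ys = q) :
    ∃ hm : braceMap x ys (q.1 + 1) ∈ HomBi 𝒜 q,
      brace x ys = DirectSum.lof K (ℕ × ℤ) (fun p => HomBi 𝒜 p) q ⟨_, hm⟩ := by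
  subst h
  exact ⟨braceMap_mem x ys, rfl⟩

theorem brace_isLinearMap_of {p q : ℕ × ℤ} (x : HomBi 𝒜 p → Cochain 𝒜)
    (ys : HomBi 𝒜 p → List (Cochain 𝒜)) (hq : ∀ w, (x w).1 + bideg (ys w) = q)
    (h : ∀ l, IsLinearMap K fun w => braceFun (x w) (ys w) l) :
    IsLinearMap K fun w => brace (x w) (ys w) := by
  choose hm he using fun w => brace_eq (x w) (ys w) q (hq w)
  simp only [he]
  refine ⟨fun a b => ?_, fun c a => ?_⟩
  · rw [← map_add]
    congr 1
    ext v; exact (h (List.ofFn v)).map_add a b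
  · rw [← map_smul]
    congr 1
    ext v; exact (h (List.ofFn v)).map_smul c a

theorem brace_isMultilinear_right (x : Cochain 𝒜) : IsMultilinearOnCochains (K := K) (brace x) := by
  intro l₁ l₂ p
  refine brace_isLinearMap_of (q := x.1 + (bideg l₁ + (p + bideg l₂))) (fun _ => x) _
    (fun w => by rw [bideg_append]) fun l => ?_
  exact sum_substitutions_isLinearMap_cochain _ l _ (evalList_isMultilinear _) rfl l₁ l₂ p

theorem brace_isLinearMap_left (ys : List (Cochain 𝒜)) (p : ℕ × ℤ) :
    IsLinearMap K fun w : HomBi 𝒜 p => brace ⟨p, w⟩ ys :=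
  brace_isLinearMap_of (q := p + bideg ys) (fun w => ⟨p, w⟩) (fun _ => ys) (fun _ => rfl)
    fun _ => isLinearMap_list_sum _ _ fun v _ => evalList_isLinearMap p v

variable [IsScalarTower K A A] [SMulCommClass K A A] [SetLike.GradedMul 𝒜]

variable (𝒜) in
/-- The multiplication `m(a, b) = a b` of `A`, an even bilinear map. -/
def mulCochain : Cochain 𝒜 :=
  ⟨(1, 0), MultilinearMap.mk' (fun a : Fin 2 → A => a 0 * a 1)
    (fun a i u v => by fin_cases i <;> simp [add_mul, mul_add])
    (fun a i c u => by fin_cases i <;> simp [smul_mul_assoc, mul_smul_comm]), by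
      intro k a h
      simpa [Fin.sum_univ_two] using SetLike.GradedMul.mul_mem (h 0) (h 1)⟩

/-- The exponent of the sign `∏_{i < j} (-1)^(d(xᵢ) + |xᵢ| + |xᵢ| d(xⱼ))` in the structure maps. -/
def signExp : List (ℕ × ℤ) → ℤ
  | [] => 0
  | p :: l => ((p.1 : ℤ) + p.2) * l.length + p.2 * l.sum.1 + signExp l

variable (𝒜) in
/-- The structure maps on homogeneous cochains: `M(1)(x) = [m, x]`, `M(2)(x, y) = ±{m}{x, y}`,
`M(1|n)(x, y₁, ..., yₙ) = ±{x}{y₁, ..., yₙ}` for `n ≥ 1`, and `M(1|0) = M(0|1) = id`; all others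
are zero. -/
def structureMap : List ℕ → List (Cochain 𝒜) → TruncatedHochschild 𝒜
  | [1], [x] => gerstenhaberBracket (mulCochain 𝒜) x
  | [2], [x, y] => (signExp [x.1, y.1]).negOnePow • brace (mulCochain 𝒜) [x, y]
  | [1, _ + 1], x :: ys =>
    (signExp (x.1 :: ys.map Sigma.fst) + (x.1.1 + x.1.2)).negOnePow • brace x ys
  | [1, 0], [x] => DirectSum.lof K (ℕ × ℤ) (fun p => HomBi 𝒜 p) x.1 x.2
  | [0, 1], [x] => DirectSum.lof K (ℕ × ℤ) (fun p => HomBi 𝒜 p) x.1 x.2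
  | _, _ => 0

theorem structureMap_isMultilinear (π : List ℕ) :
    IsMultilinearOnCochains (K := K) (structureMap 𝒜 π) := by
  intro l₁ l₂ p
  have hzero : IsLinearMap K fun _ : HomBi 𝒜 p => (0 : TruncatedHochschild 𝒜) :=
    (0 : HomBi 𝒜 p →ₗ[K] TruncatedHochschild 𝒜).isLinear
  have hsmul : ∀ (e : ℤ) (f : HomBi 𝒜 p → TruncatedHochschild 𝒜), IsLinearMap K f →
      IsLinearMap K fun w => e.negOnePow • f w := fun e f hf =>
    ⟨fun a b => by rw [hf.map_add, smul_add], fun c a => by rw [hf.map_smul, smul_comm]⟩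
  have hlof : IsLinearMap K fun w : HomBi 𝒜 p =>
      DirectSum.lof K (ℕ × ℤ) (fun p => HomBi 𝒜 p) p w := LinearMap.isLinear _
  have hb := brace_isMultilinear_right (K := K) (𝒜 := 𝒜)
  match π with
  | [1] =>
    rcases l₁ with _ | ⟨x, _ | ⟨y, l₁⟩⟩
    · rcases l₂ with _ | ⟨z, l₂⟩
      · have h₁ := hb (mulCochain 𝒜) [] [] p
        have h₂ := hsmul (((mulCochain 𝒜).1.1 : ℤ) * p.1 + (mulCochain 𝒜).1.2 * p.2) _
          (brace_isLinearMap_left [mulCochain 𝒜] p)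
        simp only [List.nil_append] at h₁
        simp only [List.nil_append, structureMap, gerstenhaberBracket]
        refine ⟨fun a b => ?_, fun c a => ?_⟩
        · rw [h₁.map_add, h₂.map_add]
          exact add_sub_add_comm (α := TruncatedHochschild 𝒜) _ _ _ _
        · rw [h₁.map_smul, h₂.map_smul]
          exact (smul_sub c _ _).symm
      · simpa [structureMap] using hzero
    · simpa [structureMap] using hzero
    · simpa [structureMap] using hzero
  | [2] =>
    rcases l₁ with _ | ⟨x, _ | ⟨y, l₁⟩⟩
    · rcases l₂ with _ | ⟨z, _ | ⟨z', l₂⟩⟩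
      · simpa [structureMap] using hzero
      · simp only [List.nil_append, structureMap]
        exact hsmul _ _ (hb (mulCochain 𝒜) [] [z] p)
      · simpa [structureMap] using hzero
    · rcases l₂ with _ | ⟨z, l₂⟩
      · simp only [List.cons_append, List.nil_append, structureMap]
        exact hsmul _ _ (hb (mulCochain 𝒜) [x] [] p)
      · simpa [structureMap] using hzero
    · rcases l₁ with _ | ⟨z, l₁⟩ <;> simpa [structureMap] using hzero
  | [1, n + 1] =>
    rcases l₁ with _ | ⟨x, l₁⟩
    · simp only [List.nil_append, structureMap]
      exact hsmul _ _ (brace_isLinearMap_left l₂ p)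
    · simp only [List.cons_append, structureMap, List.map_append, List.map_cons]
      exact hsmul _ _ (hb x l₁ l₂ p)
  | [1, 0] =>
    rcases l₁ with _ | ⟨x, _ | ⟨y, l₁⟩⟩
    · rcases l₂ with _ | ⟨z, l₂⟩
      · simpa only [List.nil_append, structureMap] using hlof
      · simpa [structureMap] using hzero
    · simpa [structureMap] using hzero
    · simpa [structureMap] using hzero
  | [0, 1] =>
    rcases l₁ with _ | ⟨x, _ | ⟨y, l₁⟩⟩
    · rcases l₂ with _ | ⟨z, l₂⟩
      · simpa only [List.nil_append, structureMap] using hlof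
      · simpa [structureMap] using hzero
    · simpa [structureMap] using hzero
    · simpa [structureMap] using hzero
  | [] => simpa [structureMap] using hzero
  | [0] => simpa [structureMap] using hzero
  | [n + 3] => simpa [structureMap] using hzero
  | [0, 0] => simpa [structureMap] using hzero
  | [0, n + 2] => simpa [structureMap] using hzero
  | [k + 2, n] => simpa [structureMap] using hzero
  | k :: n :: r :: π => simpa [structureMap] using hzero

variable (𝒜) in
/-- The structure maps `M(π)` of the truncated Hochschild complex: the multilinear extensions of
their values on homogeneous cochains. -/
def hochMaps : PartitionedMaps K (TruncatedHochschild 𝒜) := fun π =>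
  MultilinearMap.fromDirectSumEquiv fun p : Fin π.sum → ℕ × ℤ =>
    MultilinearMap.mk'
      (fun x : ∀ i, HomBi 𝒜 (p i) => structureMap 𝒜 π (List.ofFn fun i => ⟨p i, x i⟩))
      (fun x i u v => by
        have h : ∀ u, (fun j => (⟨p j, Function.update x i u j⟩ : Cochain 𝒜)) =
            Function.update (fun j => ⟨p j, x j⟩) i ⟨p i, u⟩ := fun u => by
          ext1 j; rcases eq_or_ne j i with rfl | hj <;> simp [*]
        simp only [h, ofFn_update]
        exact (structureMap_isMultilinear π _ _ (p i)).map_add u v)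
      (fun x i c u => by
        have h : ∀ u, (fun j => (⟨p j, Function.update x i u j⟩ : Cochain 𝒜)) =
            Function.update (fun j => ⟨p j, x j⟩) i ⟨p i, u⟩ := fun u => by
          ext1 j; rcases eq_or_ne j i with rfl | hj <;> simp [*]
        simp only [h, ofFn_update]
        exact (structureMap_isMultilinear π _ _ (p i)).map_smul c u)

/-- On homogeneous cochains the maps `M(π)` are given by the formulas above. -/
theorem hochMaps_apply (π : List ℕ) (x : Fin π.sum → Cochain 𝒜) :
    hochMaps 𝒜 π (fun i => DirectSum.lof K (ℕ × ℤ) (fun p => HomBi 𝒜 p) (x i).1 (x i).2) =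
      structureMap 𝒜 π (List.ofFn x) := by
  rw [hochMaps, MultilinearMap.fromDirectSumEquiv_lof]
  rfl

end Braces

end Hochschild

end GInfinity

end

noncomputable section

namespace GInfinity

/-! ### Additivity of bidegrees -/

section Bidegree

variable {K A : Type*} [Field K] [NonUnitalRing A] [Module K A] {𝒜 : ℤ → Submodule K A}

/-! Among the regular types only `(1)`, `(2)` and `(1|n)` carry a nonzero map, so the master
identity matters only for strings with one slot and for strings `(x | y₁ ... yₙ)`. Two facts about
braces settle these: associativity in the form `{m}{m} = 0` (`brace_mul_mul`), and the higher
pre-Jacobi identity (`brace_braceC`), which expands `{{x}{y₁,...,yₘ}}{z₁,...,zₙ}` as a signed sum of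
`{x}{w}` over all insertions `w` of the `z`'s into and between the `y`'s.

The pre-Jacobi identity is proved in `substSum_substSum` with an arbitrary multilinear function of
words in place of `x`, by induction on the word of arguments: its first letter stays in front of all
cochains, or is the first argument of `z₁`, or ends up in the first block of `y₁`.

Signs. Braces use the bigraded rule `d d' + s s'`, the master identity uses total degrees. The
factor `∑_{i<j} |xᵢ| d(xⱼ)` (`crossExp`) converts one rule into the other, and the sign `ε` of the
structure maps is exactly this factor times the sign in the definition of `m̃` (`signExp_eq`).
Hence, with `totalBrace` for the corrected brace, `m̃(ys)` is `{m}{ys}`, minus `±{y}{m}` if `ys` is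
a single `y`, and `m̃(x|ys)` is `(-1)^‖x‖ {x}{ys}`.

Cancellation. For type `(n)`, two cases of the pre-Jacobi identity turn the sum into `{{m}{m}}{ys} =
0`. For type `(1|n)`, expanding `{[m,x]}{ys}` and `{{x}{ys}}{m}` produces five families of terms
that cancel in pairs against the other compositions and the removal of the bar; associativity is not
needed there.

Finally, a vector of degree `k` is a sum of cochains of various bidegrees with the same total
degree. The master expression is linear in each letter once its degree is fixed, so homogeneous
cochains suffice. -/

@[simp] theorem bideg_nil : bideg ([] : List (Cochain 𝒜)) = 0 := by simp [bideg]

theorem bideg_app (l₁ l₂ : List (Cochain 𝒜)) : bideg (l₁ ++ l₂) = bideg l₁ + bideg l₂ := by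
  simp [bideg]

end Bidegree

section Substitution

variable {K A : Type*} [Field K] [NonUnitalRing A] [Module K A] {𝒜 : ℤ → Submodule K A}
  [DirectSum.Decomposition 𝒜] {B : Type*} [AddCommGroup B] [Module K B]

/-! ### The sign operators -/

/-- The exponent of the sign of the interchange of symbols of bidegrees `p` and `q`. -/
def koszul (p q : ℕ × ℤ) : ℤ := p.1 * q.1 + p.2 * q.2

theorem koszul_add (p q r : ℕ × ℤ) : koszul p (q + r) = koszul p q + koszul p r := by
  simp only [koszul, Prod.fst_add, Prod.snd_add, Nat.cast_add]; ring

@[simp] theorem koszul_zero (p : ℕ × ℤ) : koszul p 0 = 0 := by simp [koszul]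

theorem koszul_comm (p q : ℕ × ℤ) : koszul p q = koszul q p := by
  simp only [koszul]; ring

theorem pass_of_mem (p : ℕ × ℤ) {a : A} {k : ℤ} (h : a ∈ 𝒜 k) :
    pass 𝒜 p a = ((p.1 : ℤ) * (-1) + p.2 * k).negOnePow • a := by
  rw [pass, LinearMap.comp_apply, LinearEquiv.coe_coe, DirectSum.decomposeLinearEquiv_apply,
    DirectSum.decompose_of_mem _ h]
  erw [DirectSum.toModule_lof]
  rfl

theorem pass_zero (a : A) : pass 𝒜 0 a = a := by
  induction a using DirectSum.Decomposition.inductionOn 𝒜 with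
  | zero => simp
  | homogeneous a => simp [pass_of_mem 0 a.2]
  | add a b ha hb => rw [map_add, ha, hb]

theorem pass_pass (p q : ℕ × ℤ) (a : A) : pass 𝒜 p (pass 𝒜 q a) = pass 𝒜 (p + q) a := by
  induction a using DirectSum.Decomposition.inductionOn 𝒜 with
  | zero => simp
  | @homogeneous i a =>
    rw [pass_of_mem p (pass_mem q a.2), pass_of_mem q a.2, pass_of_mem _ a.2, smul_smul,
      ← Int.negOnePow_add]
    congr 2
    simp only [Prod.fst_add, Prod.snd_add, Nat.cast_add]; ring
  | add a b ha hb => simp only [map_add, ha, hb]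

theorem map_pass_zero (l : List A) : l.map (pass 𝒜 0) = l :=
  (List.map_congr_left fun a _ => pass_zero a).trans (List.map_id l)

theorem map_pass_pass (p q : ℕ × ℤ) (l : List A) :
    (l.map (pass 𝒜 q)).map (pass 𝒜 p) = l.map (pass 𝒜 (p + q)) := by
  simp [pass_pass]

theorem isLinearMap_sign (e : ℤ) : IsLinearMap K fun b : B => e.negOnePow • b :=
  ⟨fun a b => smul_add _ a b, fun c a => by rw [smul_comm]⟩

theorem isLinearMap_map_sign {C : Type*} [AddCommGroup C] [Module K C] {f : B → C}
    (hf : IsLinearMap K f) (e : ℤ) (b : B) : f (e.negOnePow • b) = e.negOnePow • f b := by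
  rcases Int.even_or_odd e with he | he
  · rw [Int.negOnePow_even _ he, one_smul, one_smul]
  · rw [Int.negOnePow_odd _ he, Units.neg_smul, Units.neg_smul, one_smul, one_smul, hf.map_neg]

/-- Expand the letters into homogeneous components one at a time from the left; the prefix treated
so far stays homogeneous. -/
theorem IsMultilinear.eq_of_homogeneous {φ ψ : List A → B} (hφ : IsMultilinear K φ)
    (hψ : IsMultilinear K ψ)
    (h : ∀ (l : List A) (ks : List ℤ), List.Forall₂ (fun a k => a ∈ 𝒜 k) l ks → φ l = ψ l)
    (l : List A) : φ l = ψ l := by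
  suffices H : ∀ (l₂ l₁ : List A) (ks : List ℤ),
      List.Forall₂ (fun a k => a ∈ 𝒜 k) l₁ ks → φ (l₁ ++ l₂) = ψ (l₁ ++ l₂) by
    simpa using H l [] [] .nil
  intro l₂
  induction l₂ with
  | nil => intro l₁ ks h₁; simpa using h l₁ ks h₁
  | cons a l₂ ih =>
    intro l₁ ks h₁
    induction a using DirectSum.Decomposition.inductionOn 𝒜 with
    | zero => rw [(hφ l₁ l₂).map_zero, (hψ l₁ l₂).map_zero]
    | @homogeneous i a =>
      have := ih (l₁ ++ [(a : A)]) (ks ++ [i])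
        (List.rel_append h₁ (.cons a.2 .nil))
      simpa using this
    | add a b ha hb => rw [(hφ l₁ l₂).map_add, (hψ l₁ l₂).map_add, ha, hb]

theorem IsMultilinear.map_pass {φ : List A → B} (hφ : IsMultilinear K φ) (p : ℕ × ℤ) :
    IsMultilinear K fun l => φ (l.map (pass 𝒜 p)) := fun l₁ l₂ => by
  simp only [List.map_append, List.map_cons]
  exact isLinearMap_comp (fun a => φ (_ ++ a :: _)) _ (hφ _ _) (pass 𝒜 p).isLinear

theorem IsMultilinear.map_pass_of_mem {φ : List A → B} (hφ : IsMultilinear K φ) (p : ℕ × ℤ)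
    {l : List A} {ks : List ℤ} (h : List.Forall₂ (fun a k => a ∈ 𝒜 k) l ks) :
    φ (l.map (pass 𝒜 p)) =
      ((p.1 : ℤ) * (-1) * l.length + p.2 * ks.sum).negOnePow • φ l := by
  induction h generalizing φ with
  | nil => simp
  | @cons a k l ks ha hl ih =>
    have h₁ : φ (pass 𝒜 p a :: l.map (pass 𝒜 p)) =
        ((p.1 : ℤ) * (-1) + p.2 * k).negOnePow • φ (a :: l.map (pass 𝒜 p)) := by
      rw [pass_of_mem p ha]
      exact isLinearMap_map_sign (hφ [] _) _ a
    rw [List.map_cons, h₁, ih (hφ.cons a), smul_smul, ← Int.negOnePow_add]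
    congr 2
    simp only [List.length_cons, List.sum_cons, Nat.cast_add, Nat.cast_one]; ring

/-- Passing the value `y(l)` is the same as passing `y` and each letter of `l`: super degrees add
up, and `d(y(l)) = d(y) - (d(y) + 1) = -1` is the bidegree of an element of `A`. -/
theorem pass_evalList (p : ℕ × ℤ) (y : Cochain 𝒜) (l : List A) :
    pass 𝒜 p (evalList y.2.1 l) =
      (koszul p y.1).negOnePow • evalList y.2.1 (l.map (pass 𝒜 p)) := by
  have hy := evalList_isMultilinear y.2.1
  refine IsMultilinear.eq_of_homogeneous (K := K) (𝒜 := 𝒜)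
    (φ := fun l => pass 𝒜 p (evalList y.2.1 l))
    (ψ := fun l => (koszul p y.1).negOnePow • evalList y.2.1 (l.map (pass 𝒜 p)))
    (fun l₁ l₂ => isLinearMap_comp _ _ (pass 𝒜 p).isLinear (hy l₁ l₂))
    (fun l₁ l₂ => isLinearMap_comp _ _ (isLinearMap_sign _) ((hy.map_pass p) l₁ l₂))
    (fun l ks h => ?_) l
  simp only [pass_of_mem p (evalList_mem y l ks h), hy.map_pass_of_mem p h, smul_smul,
    ← Int.negOnePow_add]
  -- For a word of the wrong length `evalList` is zero on both sides, so the sign plays no role.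
  by_cases hl : l.length = y.1.1 + 1
  · congr 2
    simp only [hl, koszul]; push_cast; ring
  · simp [evalList, hl]

end Substitution

/-! ### Cutting lists -/

section Lists

variable {α β : Type*}

/-- All ways to write a list as `b ++ c`. -/
def splits : List α → List (List α × List α)
  | [] => [([], [])]
  | a :: l => ([], a :: l) :: (splits l).map fun t => (a :: t.1, t.2)

theorem sum_splits_nil [AddMonoid β] (f : List α × List α → β) :
    ((splits []).map f).sum = f ([], []) := by simp [splits]

theorem sum_splits_cons [AddMonoid β] (f : List α × List α → β) (a : α) (l : List α) :
    ((splits (a :: l)).map f).sum =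
      f ([], a :: l) + ((splits l).map fun t => f (a :: t.1, t.2)).sum := by
  simp [splits, Function.comp_def]

theorem append_of_mem_splits {l : List α} {t : List α × List α} (h : t ∈ splits l) :
    t.1 ++ t.2 = l := by
  induction l generalizing t with
  | nil => simp_all [splits]
  | cons a l ih =>
    rcases List.mem_cons.1 h with rfl | h
    · rfl
    · obtain ⟨t', h', rfl⟩ := List.mem_map.1 h
      simp [ih h']

/-- Apply `f` to the first `n` letters and the rest of `l`; zero if `l` is too short. -/
def cutAt [Zero β] (n : ℕ) (l : List α) (f : List α → List α → β) : β :=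
  if n ≤ l.length then f (l.take n) (l.drop n) else 0

@[simp] theorem cutAt_zero [Zero β] (l : List α) (f : List α → List α → β) :
    cutAt 0 l f = f [] l := by simp [cutAt]

@[simp] theorem cutAt_succ_nil [Zero β] (n : ℕ) (f : List α → List α → β) :
    cutAt (n + 1) [] f = 0 := by simp [cutAt]

@[simp] theorem cutAt_succ_cons [Zero β] (n : ℕ) (a : α) (l : List α) (f : List α → List α → β) :
    cutAt (n + 1) (a :: l) f = cutAt n l fun u v => f (a :: u) v := by simp [cutAt]

/-- Associativity of cutting: removing `m` and then `n` letters amounts to removing `m + n` and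
cutting the removed part at `m`. -/
theorem cutAt_cutAt [Zero β] (m n : ℕ) (l : List α) (f : List α → List α → List α → β) :
    cutAt m l (fun u v => cutAt n v (f u)) =
      cutAt (m + n) l fun u r => cutAt m u fun u v => f u v r := by
  induction m generalizing l f with
  | zero => simp
  | succ m ih =>
    rw [Nat.succ_add]
    cases l with
    | nil => simp
    | cons a l => simpa using ih l fun u => f (a :: u)

theorem cutAt_map [Zero β] {γ : Type*} (g : γ → α) (n : ℕ) (l : List γ)
    (f : List α → List α → β) :
    cutAt n (l.map g) f = cutAt n l fun u v => f (u.map g) (v.map g) := by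
  simp [cutAt]

theorem cutAt_congr [Zero β] {n : ℕ} {l : List α} {f g : List α → List α → β}
    (h : ∀ u v, u.length = n → u ++ v = l → f u v = g u v) : cutAt n l f = cutAt n l g := by
  unfold cutAt
  split_ifs with hn
  · exact h _ _ (by simpa using hn) (List.take_append_drop n l)
  · rfl

theorem cutAt_zero_fun [Zero β] (n : ℕ) (l : List α) :
    (cutAt n l fun _ _ => (0 : β)) = 0 := by simp [cutAt]

theorem cutAt_add_fun [AddMonoid β] (n : ℕ) (l : List α) (f g : List α → List α → β) :
    (cutAt n l fun u v => f u v + g u v) = cutAt n l f + cutAt n l g := by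
  unfold cutAt
  split_ifs <;> simp

theorem cutAt_sum [AddMonoid β] {ι : Type*} (n : ℕ) (l : List α) (I : List ι)
    (f : ι → List α → List α → β) :
    (cutAt n l fun u v => (I.map fun i => f i u v).sum) = (I.map fun i => cutAt n l (f i)).sum := by
  unfold cutAt
  split_ifs <;> simp

theorem map_cutAt {γ : Type*} [Zero β] [Zero γ] (g : β → γ) (hg : g 0 = 0) (n : ℕ) (l : List α)
    (f : List α → List α → β) : g (cutAt n l f) = cutAt n l fun u v => g (f u v) := by
  unfold cutAt
  split_ifs <;> simp [hg]

end Lists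

/-! ### Sums over substitutions -/

section Substitution

variable {K A : Type*} [Field K] [NonUnitalRing A] [Module K A] {𝒜 : ℤ → Submodule K A}
  [DirectSum.Decomposition 𝒜] {B : Type*} [AddCommGroup B]

/-- The sum of `φ` over all substitutions of `l` into `y₁, ..., yₙ`. -/
def substSum (ys : List (Cochain 𝒜)) (φ : List A → B) (l : List A) : B :=
  ((substitutions ys l).map φ).sum

theorem substSum_nil (φ : List A → B) (l : List A) :
    substSum ([] : List (Cochain 𝒜)) φ l = φ l := by simp [substSum, substitutions]

theorem substSum_cons_nil (y : Cochain 𝒜) (ys : List (Cochain 𝒜)) (φ : List A → B) :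
    substSum (y :: ys) φ [] = 0 := by simp [substSum, substitutions]

/-- The recursion behind all inductions below: the first letter either stays in front, passing every
cochain, or opens the arguments of the first cochain. -/
theorem substSum_cons_cons (y : Cochain 𝒜) (ys : List (Cochain 𝒜)) (φ : List A → B) (a : A)
    (l : List A) :
    substSum (y :: ys) φ (a :: l) =
      substSum (y :: ys) (fun w => φ (pass 𝒜 (bideg (y :: ys)) a :: w)) l +
      cutAt y.1.1 l fun u v => substSum ys
        (fun w => φ (evalList y.2.1 ((a :: u).map (pass 𝒜 (bideg ys))) :: w)) v := by
  rw [substSum, sum_substitutions_cons]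
  rfl

/-- Each `y` replaces `d(y) + 1` consecutive letters by one. -/
theorem length_of_mem_substitutions (n : ℕ) : ∀ (ys : List (Cochain 𝒜)) (l : List A),
    l.length = n → ∀ w ∈ substitutions ys l,
      w.length + (bideg ys).1 = l.length ∧ ys.length ≤ w.length := by
  induction n using Nat.strong_induction_on with
  | _ n ih =>
  intro ys l hn w hw
  rcases ys with _ | ⟨y, ys⟩
  · simp_all [substitutions]
  rcases l with _ | ⟨a, l⟩
  · simp [substitutions] at hw
  simp only [List.length_cons] at hn
  rw [substitutions, List.mem_append] at hw
  rcases hw with hw | hw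
  · obtain ⟨w, hw', rfl⟩ := List.mem_map.1 hw
    obtain ⟨h₁, h₂⟩ := ih l.length (by omega) _ _ rfl w hw'
    simp only [List.length_cons] at h₁ h₂ ⊢
    omega
  · split_ifs at hw with hd
    · obtain ⟨w, hw', rfl⟩ := List.mem_map.1 hw
      obtain ⟨h₁, h₂⟩ := ih (l.drop y.1.1).length (by simp; omega) _ _ rfl w hw'
      simp only [List.length_cons, List.length_drop, bideg_cons, Prod.fst_add] at h₁ h₂ ⊢
      omega
    · simp at hw

theorem substSum_congr (ys : List (Cochain 𝒜)) {φ ψ : List A → B} (l : List A)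
    (h : ∀ w : List A, w.length + (bideg ys).1 = l.length → φ w = ψ w) :
    substSum ys φ l = substSum ys ψ l :=
  congrArg List.sum (List.map_congr_left fun w hw =>
    h w (length_of_mem_substitutions _ ys l rfl w hw).1)

theorem substSum_eq_zero {ys : List (Cochain 𝒜)} (φ : List A → B) {l : List A}
    (h : l.length < ys.length + (bideg ys).1) : substSum ys φ l = 0 := by
  have h₀ : substitutions ys l = [] := List.eq_nil_iff_forall_not_mem.2 fun w hw => by
    have := length_of_mem_substitutions _ ys l rfl w hw
    omega
  simp [substSum, h₀]

theorem substSum_add (ys : List (Cochain 𝒜)) (φ ψ : List A → B) (l : List A) :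
    substSum ys (fun w => φ w + ψ w) l = substSum ys φ l + substSum ys ψ l :=
  List.sum_map_add

theorem map_substSum [Module K B] {C : Type*} [AddCommGroup C] [Module K C] {f : B → C}
    (hf : IsLinearMap K f) (ys : List (Cochain 𝒜)) (φ : List A → B) (l : List A) :
    f (substSum ys φ l) = substSum ys (fun w => f (φ w)) l := by
  have := map_list_sum (IsLinearMap.mk' f hf) ((substitutions ys l).map φ)
  simpa [substSum, Function.comp_def] using this

theorem substSum_sign (ys : List (Cochain 𝒜)) (e : ℤ) (φ : List A → B) (l : List A) :
    substSum ys (fun w => e.negOnePow • φ w) l = e.negOnePow • substSum ys φ l := by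
  simp only [substSum, List.smul_sum, List.map_map, Function.comp_def]

/-- A symbol that passes the substituted word passes the cochains and the original letters;
`pass_evalList` gives this for each substituted letter. -/
theorem substSum_map_pass [Module K B] (p : ℕ × ℤ) (ys : List (Cochain 𝒜)) {φ : List A → B}
    (hφ : IsMultilinear K φ) (l : List A) :
    substSum ys (fun w => φ (w.map (pass 𝒜 p))) l =
      (koszul p (bideg ys)).negOnePow • substSum ys φ (l.map (pass 𝒜 p)) := by
  induction h : l.length using Nat.strong_induction_on generalizing ys φ l with
  | _ n ih =>
  rcases ys with _ | ⟨y, ys⟩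
  · simp [substSum_nil]
  rcases l with _ | ⟨a, l⟩
  · simp [substSum_cons_nil]
  rw [List.map_cons, substSum_cons_cons, substSum_cons_cons, smul_add]
  congr 1
  · simp only [List.map_cons, pass_pass, add_comm p]
    exact ih l.length (by simp at h; omega) _ (hφ.cons _) l rfl
  · rw [cutAt_map, map_cutAt _ (smul_zero _)]
    refine cutAt_congr fun u v hu huv => ?_
    have hv : v.length < n := by rw [← h, ← huv]; simp
    have hs := fun w => isLinearMap_map_sign (hφ [] w) (koszul p y.1)
    simp only [List.nil_append] at hs
    simp only [List.map_cons, pass_evalList, hs]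
    rw [substSum_sign, ih v.length hv ys (hφ.cons _) v rfl, smul_smul, ← Int.negOnePow_add,
      bideg_cons, koszul_add]
    simp only [map_pass_pass, pass_pass, add_comm p]

/-- Cutting the substituted word after `d` letters separates the cochains that landed in the first
part, `t.1`, from the rest, `t.2`. The first part came from `d + d(t.1)` original letters, and these
have also passed `t.2`, whence the operator `pass` on `u`. -/
theorem substSum_cutAt (d : ℕ) (zs : List (Cochain 𝒜)) (ψ : List A → List A → B) (l : List A) :
    substSum zs (fun w => cutAt d w ψ) l =
      ((splits zs).map fun t => cutAt (d + (bideg t.1).1) l fun u v =>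
        substSum t.1 (fun w => substSum t.2 (ψ w) v) (u.map (pass 𝒜 (bideg t.2)))).sum := by
  induction h : l.length using Nat.strong_induction_on generalizing d zs ψ l with
  | _ n ih =>
  rcases d with _ | d
  · rcases zs with _ | ⟨z, zs⟩
    · simp [sum_splits_nil, substSum_nil]
    · rw [sum_splits_cons]
      simp only [cutAt_zero, bideg_nil, substSum_nil, List.map_nil, Prod.fst_zero, add_zero,
        left_eq_add]
      -- A nonempty `t.1` contributes nothing: it would need at least one letter more than the
      -- `d(t.1)` letters that it is given.
      refine List.sum_eq_zero fun b hb => ?_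
      obtain ⟨t, -, rfl⟩ := List.mem_map.1 hb
      refine (cutAt_congr fun u v hu _ => ?_).trans (cutAt_zero_fun (β := B) _ l)
      apply substSum_eq_zero
      simp [hu]
  rcases l with _ | ⟨a, l⟩
  · have h₀ : ∀ t : List (Cochain 𝒜) × List (Cochain 𝒜),
        (cutAt (d + 1 + (bideg t.1).1) [] fun u v => substSum t.1
          (fun w => substSum t.2 (ψ w) v) (u.map (pass 𝒜 (bideg t.2)))) = 0 := fun t => by
      rw [add_right_comm, cutAt_succ_nil]
    simp only [h₀]
    rcases zs with _ | ⟨z, zs⟩ <;> simp [substSum_nil, substSum_cons_nil]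
  rcases zs with _ | ⟨z, zs⟩
  · simp [sum_splits_nil, substSum_nil, map_pass_zero]
  simp only [List.length_cons] at h
  rw [sum_splits_cons, substSum_cons_cons]
  simp only [cutAt_succ_cons, bideg_nil, Prod.fst_zero, add_zero, substSum_nil]
  rw [ih l.length (by omega) d (z :: zs) _ l rfl, sum_splits_cons]
  simp only [bideg_nil, Prod.fst_zero, add_zero, substSum_nil, List.map_cons, add_assoc]
  congr 1
  -- The terms in which the first letter is an argument of `z`: the induction hypothesis is applied
  -- to the word after these arguments, and the nested cuts are merged by `cutAt_cutAt`.
  have h₁ : (cutAt z.1.1 l fun u v => substSum zs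
      (fun w => cutAt d w fun u' v' => ψ (evalList z.2.1
        (pass 𝒜 (bideg zs) a :: u.map (pass 𝒜 (bideg zs))) :: u') v') v) =
      ((splits zs).map fun t => cutAt (z.1.1 + (d + (bideg t.1).1)) l fun u r => cutAt z.1.1 u
        fun u v => substSum t.1 (fun w => substSum t.2 (ψ (evalList z.2.1
          (pass 𝒜 (bideg zs) a :: u.map (pass 𝒜 (bideg zs))) :: w)) r)
            (v.map (pass 𝒜 (bideg t.2)))).sum := by
    simp only [← cutAt_cutAt, ← cutAt_sum]
    refine cutAt_congr fun u v _ huv => ih v.length ?_ d zs _ v rfl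
    have := congrArg List.length huv
    simp at this; omega
  rw [h₁, ← List.sum_map_add]
  refine congrArg List.sum (List.map_congr_left fun t ht => ?_)
  have hb : bideg zs = bideg t.1 + bideg t.2 := by
    rw [← append_of_mem_splits ht, bideg_app]
  rw [show d + (1 + (bideg (z :: t.1)).1) = d + (bideg (z :: t.1)).1 + 1 by ring, cutAt_succ_cons,
    show z.1.1 + (d + (bideg t.1).1) = d + (bideg (z :: t.1)).1 by
      rw [bideg_cons, Prod.fst_add]; ring, ← cutAt_add_fun]
  refine cutAt_congr fun u v _ _ => ?_
  rw [List.map_cons, substSum_cons_cons, cutAt_map]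
  simp only [List.map_cons, pass_pass, map_pass_pass, bideg_cons, hb, add_assoc]

end Substitution

/-! ### Composition of braces -/

section Ext

variable {K A : Type*} [Field K] [NonUnitalRing A] [Module K A] {𝒜 : ℤ → Submodule K A}

theorem evalList_ofFn {n : ℕ} (x : MultilinearMap K (fun _ : Fin n => A) A) (a : Fin n → A) :
    evalList x (List.ofFn a) = x a := by
  simp [evalList]

theorem cochain_ext {x y : Cochain 𝒜} (h : x.1 = y.1)
    (h' : ∀ l : List A, l.length = x.1.1 + 1 → evalList x.2.1 l = evalList y.2.1 l) : x = y := by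
  obtain ⟨p, x⟩ := x
  obtain ⟨q, y⟩ := y
  obtain rfl : p = q := h
  congr 1
  ext a
  simpa only [evalList_ofFn] using h' (List.ofFn a) (by simp)

end Ext

/-! ### Insertions of one list of cochains into another, and the pre-Jacobi identity -/

section Merge

variable {K A : Type*} [Field K] [NonUnitalRing A] [Module K A] {𝒜 : ℤ → Submodule K A}
  [DirectSum.Decomposition 𝒜] {B : Type*} [AddCommGroup B]

/-- The brace of homogeneous cochains as a homogeneous cochain. -/
def braceC (x : Cochain 𝒜) (ys : List (Cochain 𝒜)) : Cochain 𝒜 :=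
  ⟨x.1 + bideg ys, ⟨_, braceMap_mem x ys⟩⟩

theorem braceC_fst (x : Cochain 𝒜) (ys : List (Cochain 𝒜)) :
    (braceC x ys).1 = x.1 + bideg ys := rfl

theorem evalList_braceC (x : Cochain 𝒜) (ys : List (Cochain 𝒜)) {l : List A}
    (h : l.length = x.1.1 + (bideg ys).1 + 1) :
    evalList (braceC x ys).2.1 l = substSum ys (evalList x.2.1) l := by
  have h' : l.length = (braceC x ys).1.1 + 1 := h
  rw [evalList, dif_pos h']
  change braceFun x ys (List.ofFn fun i : Fin ((braceC x ys).1.1 + 1) => l.get (i.cast h'.symm)) = _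
  have e : (List.ofFn fun i : Fin ((braceC x ys).1.1 + 1) => l.get (i.cast h'.symm)) = l := by
    apply List.ext_getElem <;> simp [h', -List.ofFn_succ]
  rw [e]
  rfl

theorem braceC_nil (x : Cochain 𝒜) : braceC x [] = x :=
  cochain_ext (by simp [braceC_fst]) fun l hl => by
    rw [evalList_braceC _ _ (by simpa [braceC_fst] using hl), substSum_nil]

/-- One step of `merge`: the first letter of the merged list is either `z` or `{y}{z₁, ..., zⱼ}`. -/
def mergeStep (M : List (Cochain 𝒜) → List (ℤ × List (Cochain 𝒜))) (y : Cochain 𝒜)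
    (ys : List (Cochain 𝒜)) : List (Cochain 𝒜) → List (ℤ × List (Cochain 𝒜))
  | [] => (M []).map fun r => (r.1, y :: r.2)
  | z :: zs =>
    ((mergeStep M y ys zs).map fun r => (koszul (bideg (y :: ys)) z.1 + r.1, z :: r.2)) ++
      (splits (z :: zs)).flatMap fun t => (M t.2).map fun r =>
        (koszul (bideg ys) (bideg t.1) + r.1, braceC y t.1 :: r.2)

/-- All ways to insert the cochains `z₁, ..., zₙ` into and between the cochains `y₁, ..., yₘ`, each
with the exponent of its sign. -/
def merge : List (Cochain 𝒜) → List (Cochain 𝒜) → List (ℤ × List (Cochain 𝒜))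
  | [], zs => [(0, zs)]
  | y :: ys, zs => mergeStep (merge ys) y ys zs

/-- The signed sum of `f` over `merge ys zs`. -/
def mergeSum (ys zs : List (Cochain 𝒜)) (f : List (Cochain 𝒜) → B) : B :=
  ((merge ys zs).map fun r => r.1.negOnePow • f r.2).sum

theorem merge_nil (ys : List (Cochain 𝒜)) : merge ys [] = [(0, ys)] := by
  induction ys with
  | nil => rfl
  | cons y ys ih => simp [merge, mergeStep, ih]

theorem mergeSum_nil_left (zs : List (Cochain 𝒜)) (f : List (Cochain 𝒜) → B) :
    mergeSum [] zs f = f zs := by simp [mergeSum, merge]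

theorem mergeSum_nil_right (ys : List (Cochain 𝒜)) (f : List (Cochain 𝒜) → B) :
    mergeSum ys [] f = f ys := by simp [mergeSum, merge_nil]

theorem sum_map_flatMap {ι κ : Type*} (L : List ι) (g : ι → List κ) (f : κ → B) :
    ((L.flatMap g).map f).sum = (L.map fun i => ((g i).map f).sum).sum := by
  induction L with
  | nil => simp
  | cons i L ih => simp [ih]

theorem mergeSum_cons_cons (y : Cochain 𝒜) (ys : List (Cochain 𝒜)) (z : Cochain 𝒜)
    (zs : List (Cochain 𝒜)) (f : List (Cochain 𝒜) → B) :
    mergeSum (y :: ys) (z :: zs) f =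
      (koszul (bideg (y :: ys)) z.1).negOnePow • mergeSum (y :: ys) zs (fun w => f (z :: w)) +
      ((splits (z :: zs)).map fun t => (koszul (bideg ys) (bideg t.1)).negOnePow •
        mergeSum ys t.2 fun w => f (braceC y t.1 :: w)).sum := by
  simp only [mergeSum, merge, mergeStep, List.map_append, List.sum_append, sum_map_flatMap,
    List.map_map, Function.comp_def, List.smul_sum, smul_smul, Int.negOnePow_add]

/-- All merged lists have the same total bidegree, so the sign that a letter acquires by passing the
whole list is common to all terms of a merge. -/
theorem of_mem_merge {ys zs : List (Cochain 𝒜)} {r : ℤ × List (Cochain 𝒜)}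
    (h : r ∈ merge ys zs) : bideg r.2 = bideg ys + bideg zs ∧ (ys ≠ [] → r.2 ≠ []) := by
  induction ys generalizing zs r with
  | nil => simp_all [merge]
  | cons y ys ihy =>
    induction zs generalizing r with
    | nil => simp_all [merge_nil]
    | cons z zs ihz =>
      rw [merge, mergeStep, List.mem_append] at h
      rcases h with h | h
      · obtain ⟨r, hr, rfl⟩ := List.mem_map.1 h
        refine ⟨?_, by simp⟩
        rw [bideg_cons, (ihz hr).1, bideg_cons _ z]
        abel
      · obtain ⟨t, ht, h⟩ := List.mem_flatMap.1 h
        obtain ⟨r, hr, rfl⟩ := List.mem_map.1 h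
        refine ⟨?_, by simp⟩
        rw [bideg_cons, (ihy hr).1, ← append_of_mem_splits ht, bideg_app, braceC_fst, bideg_cons]
        abel

theorem mergeSum_congr {ys zs : List (Cochain 𝒜)} {f g : List (Cochain 𝒜) → B}
    (h : ∀ w, bideg w = bideg ys + bideg zs → (ys ≠ [] → w ≠ []) → f w = g w) :
    mergeSum ys zs f = mergeSum ys zs g :=
  congrArg List.sum (List.map_congr_left fun r hr => by
    rw [h r.2 (of_mem_merge hr).1 (of_mem_merge hr).2])

theorem mergeSum_add (ys zs : List (Cochain 𝒜)) (f g : List (Cochain 𝒜) → B) :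
    mergeSum ys zs (fun w => f w + g w) = mergeSum ys zs f + mergeSum ys zs g := by
  simp only [mergeSum, smul_add, List.sum_map_add]

theorem mergeSum_cutAt (ys zs : List (Cochain 𝒜)) (n : ℕ) (l : List A)
    (f : List (Cochain 𝒜) → List A → List A → B) :
    mergeSum ys zs (fun w => cutAt n l (f w)) =
      cutAt n l fun u v => mergeSum ys zs fun w => f w u v := by
  simp only [mergeSum, cutAt_sum, map_cutAt _ (smul_zero _)]

/-- The higher pre-Jacobi identity, for sums over substitutions. -/
theorem substSum_substSum [Module K B] (ys zs : List (Cochain 𝒜)) {φ : List A → B}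
    (hφ : IsMultilinear K φ) (l : List A) :
    substSum zs (substSum ys φ) l = mergeSum ys zs fun w => substSum w φ l := by
  -- Letters already placed are absorbed into `φ`, which therefore varies in the induction.
  induction h : l.length using Nat.strong_induction_on generalizing ys zs φ l with
  | _ n ih =>
  rcases ys with _ | ⟨y, ys⟩
  · rw [mergeSum_nil_left]
    exact congrArg (fun f => substSum zs f l) (funext (substSum_nil φ))
  rcases zs with _ | ⟨z, zs⟩
  · rw [mergeSum_nil_right, substSum_nil]
  rcases l with _ | ⟨a, l⟩
  · rw [substSum_cons_nil, mergeSum_congr (g := fun _ => (0 : B))]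
    · simp [mergeSum]
    · rintro (_ | ⟨c, w⟩) _ hw
      · simp at hw
      · rw [substSum_cons_nil]
  simp only [List.length_cons] at h
  have hlin (b : List A) := fun e b' => isLinearMap_map_sign (hφ [] b) e b'
  simp only [List.nil_append] at hlin
  -- the substitutions in which `a` is an argument of the first cochain
  let H : List (Cochain 𝒜) → B
    | [] => 0
    | c :: w => cutAt c.1.1 l fun u v => substSum w
        (fun w' => φ (evalList c.2.1 ((a :: u).map (pass 𝒜 (bideg w))) :: w')) v
  have hR : mergeSum (y :: ys) (z :: zs) (fun w => substSum w φ (a :: l)) =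
      mergeSum (y :: ys) (z :: zs) (fun w => substSum w
        (fun w' => φ (pass 𝒜 (bideg (y :: ys) + bideg (z :: zs)) a :: w')) l) +
      mergeSum (y :: ys) (z :: zs) H := by
    rw [← mergeSum_add]
    refine mergeSum_congr ?_
    rintro (_ | ⟨c, w⟩) hw hw'
    · simp at hw'
    · rw [substSum_cons_cons, hw]
  -- The first merged cochain is `z`. It was moved to the left of all the `y`'s, and `pass_evalList`
  -- yields the matching sign when its value passes them.
  have hH₁ : (koszul (bideg (y :: ys)) z.1).negOnePow •
        mergeSum (y :: ys) zs (fun w => H (z :: w)) =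
      cutAt z.1.1 l fun u v => substSum zs (substSum (y :: ys) fun w => φ
        (pass 𝒜 (bideg (y :: ys)) (evalList z.2.1 ((a :: u).map (pass 𝒜 (bideg zs)))) :: w)) v := by
    rw [mergeSum_congr (g := fun w => cutAt z.1.1 l fun u v => substSum w (fun w' =>
        φ (evalList z.2.1 ((a :: u).map (pass 𝒜 (bideg (y :: ys) + bideg zs))) :: w')) v)
      (fun w hw _ => by rw [← hw]), mergeSum_cutAt, map_cutAt _ (smul_zero _)]
    refine cutAt_congr fun u v _ huv => ?_
    have hv : v.length < n := by rw [← h, ← huv]; simp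
    rw [← ih v.length hv (y :: ys) zs (hφ.cons _) v rfl]
    simp only [pass_evalList, hlin, map_pass_pass]
    rw [← substSum_sign]
    exact congrArg (fun f => substSum zs f v) (funext fun w => (substSum_sign _ _ _ w).symm)
  -- The first merged cochain is `y` with `t.1` inserted. Its `d(y) + 1` arguments are the leading
  -- letters of the word obtained by substituting into the `z`'s, so `substSum_cutAt` applies with
  -- `d = d(y) + 1`.
  have hH₂ : ((splits (z :: zs)).map fun t => (koszul (bideg ys) (bideg t.1)).negOnePow •
        mergeSum ys t.2 fun w => H (braceC y t.1 :: w)).sum =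
      substSum (z :: zs) (fun w => cutAt (y.1.1 + 1) w fun u v => substSum ys
        (fun w => φ (evalList y.2.1 (u.map (pass 𝒜 (bideg ys))) :: w)) v) (a :: l) := by
    rw [substSum_cutAt]
    refine congrArg List.sum (List.map_congr_left fun t _ => ?_)
    rw [add_right_comm, cutAt_succ_cons,
      mergeSum_congr (g := fun w => cutAt (y.1.1 + (bideg t.1).1) l fun u v => substSum w (fun w' =>
        φ (evalList (braceC y t.1).2.1 ((a :: u).map (pass 𝒜 (bideg ys + bideg t.2))) :: w')) v)
      (fun w hw _ => by rw [← hw]; rfl), mergeSum_cutAt, map_cutAt _ (smul_zero _)]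
    refine cutAt_congr fun u v hu huv => ?_
    have hv : v.length < n := by rw [← h, ← huv]; simp
    rw [← ih v.length hv ys t.2 (hφ.cons _) v rfl, evalList_braceC _ _ (by simp [hu]),
      ← map_pass_pass]
    have hG : IsLinearMap K fun b => substSum t.2 (substSum ys fun w => φ (b :: w)) v :=
      isLinearMap_list_sum _ _ fun _ _ => isLinearMap_list_sum _ _ fun w _ => hφ [] w
    rw [← isLinearMap_map_sign hG, ← substSum_map_pass _ _ (evalList_isMultilinear _)]
    exact map_substSum hG _ _ _
  rw [hR, mergeSum_cons_cons _ _ _ _ H, hH₁, hH₂, substSum_cons_cons, substSum_cons_cons]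
  simp only [substSum_cons_cons y ys, substSum_add, cutAt_add_fun, cutAt_succ_cons, List.map_cons]
  rw [← ih l.length (by omega) (y :: ys) (z :: zs) (hφ.cons _) l rfl]
  simp only [pass_pass]
  abel

end Merge

/-! ### Lists with a marked sublist -/

section Lists

variable {α B : Type*}

theorem splits_eq_range (l : List α) :
    splits l = (List.range (l.length + 1)).map fun i => (l.take i, l.drop i) := by
  induction l with
  | nil => simp [splits]
  | cons a l ih =>
    rw [splits, ih, List.length_cons, List.range_succ_eq_map (n := l.length + 1)]
    simp [Function.comp_def]

/-- The marked part either starts at the first letter or lies in the tail. -/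
theorem cuts_cons (a : α) (l : List α) :
    cuts (a :: l) = (splits l).map (fun t => ([], a :: t.1, t.2)) ++
      (cuts l).map fun t => (a :: t.1, t.2.1, t.2.2) := by
  rw [cuts, List.length_cons, List.range_succ_eq_map (n := l.length), List.flatMap_cons,
    List.flatMap_map, splits_eq_range, cuts, List.map_flatMap]
  simp [Function.comp_def]

theorem sum_cuts_cons [AddMonoid B] (f : List α × List α × List α → B) (a : α) (l : List α) :
    ((cuts (a :: l)).map f).sum =
      ((splits l).map fun t => f ([], a :: t.1, t.2)).sum +
        ((cuts l).map fun t => f (a :: t.1, t.2.1, t.2.2)).sum := by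
  simp [cuts_cons, Function.comp_def]

theorem append_of_mem_cuts {l : List α} {t : List α × List α × List α} (h : t ∈ cuts l) :
    t.1 ++ (t.2.1 ++ t.2.2) = l ∧ t.2.1 ≠ [] := by
  induction l generalizing t with
  | nil => simp [cuts] at h
  | cons a l ih =>
    rw [cuts_cons, List.mem_append] at h
    rcases h with h | h
    · obtain ⟨t, ht, rfl⟩ := List.mem_map.1 h
      simp [append_of_mem_splits ht]
    · obtain ⟨t, ht, rfl⟩ := List.mem_map.1 h
      simp [ih ht]

/-- A subdivision `b c d` has `c` nonempty or empty. For braces this separates the terms in which a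
cochain takes arguments from those in which it is merely inserted. -/
theorem sum_cuts_add_sum_splits [AddCommMonoid B] (f : List α → List α → List α → B)
    (l : List α) :
    ((splits l).map fun t => ((splits t.2).map fun t' => f t.1 t'.1 t'.2).sum).sum =
      ((cuts l).map fun t => f t.1 t.2.1 t.2.2).sum +
        ((splits l).map fun t => f t.1 [] t.2).sum := by
  induction l generalizing f with
  | nil => simp [splits, cuts]
  | cons a l ih =>
    rw [sum_splits_cons, ih fun b => f (a :: b), sum_splits_cons, sum_cuts_cons, sum_splits_cons]
    abel

/-- `f y` for a word with a single letter `y`, and zero otherwise. -/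
def onSingle [Zero B] (f : α → B) : List α → B
  | [y] => f y
  | _ => 0

theorem sum_splits_onSingle [AddCommMonoid B] (f : α → List α → B) (a : α) (l : List α) :
    ((splits l).map fun t => onSingle (fun y => f y t.2) (a :: t.1)).sum = f a l := by
  cases l with
  | nil => simp [splits, onSingle]
  | cons b l =>
    rw [sum_splits_cons, List.sum_eq_zero]
    · simp [onSingle]
    · simp [onSingle]

end Lists

/-! ### Braces with total signs -/

/-- Signs are compared by casting exponents to `ZMod 2`, where the needed polynomial identities are
checked by `ring_nf` and `reduce_mod_char`. -/
theorem negOnePow_congr {e e' : ℤ} (h : (e : ZMod 2) = e') : e.negOnePow = e'.negOnePow := by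
  rw [Int.negOnePow_eq_iff, ← ZMod.intCast_eq_zero_iff_even]
  simp [h]

section Total

variable {K A : Type*} [Field K] [NonUnitalRing A] [Module K A] {𝒜 : ℤ → Submodule K A}

/-- A homogeneous cochain as an element of the truncated Hochschild complex. -/
def emb (c : Cochain 𝒜) : TruncatedHochschild 𝒜 :=
  DirectSum.lof K (ℕ × ℤ) (fun p => HomBi 𝒜 p) c.1 c.2

/-- The value of a component of an element of the truncated Hochschild complex on a word. -/
def component (q : ℕ × ℤ) (l : List A) (v : TruncatedHochschild 𝒜) : A := evalList (v q).1 l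

theorem eq_of_component {v w : TruncatedHochschild 𝒜}
    (h : ∀ (q : ℕ × ℤ) (l : List A), l.length = q.1 + 1 → component q l v = component q l w) :
    v = w := by
  refine DFinsupp.ext fun q => Subtype.ext (MultilinearMap.ext fun a => ?_)
  simpa only [component, evalList_ofFn] using h q (List.ofFn a) (by simp)

theorem component_emb (c : Cochain 𝒜) (q : ℕ × ℤ) (l : List A) :
    component q l (emb c) = if c.1 = q then evalList c.2.1 l else 0 := by
  obtain ⟨p, x⟩ := c
  unfold component emb
  split_ifs with h
  · obtain rfl : p = q := h
    rw [DirectSum.lof_apply]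
  · rw [DirectSum.lof_eq_of, DirectSum.of_eq_of_ne _ _ _ (Ne.symm h)]
    simp [evalList]

/-- The total degree `d(x) + |x|` of a homogeneous cochain of bidegree `(d(x), |x|)`. -/
def tot (p : ℕ × ℤ) : ℤ := p.1 + p.2

theorem tot_add (p q : ℕ × ℤ) : tot (p + q) = tot p + tot q := by
  simp only [tot, Prod.fst_add, Prod.snd_add]; push_cast; ring

@[simp] theorem tot_zero : tot 0 = 0 := by simp [tot]

/-- `∑_{i < j} |xᵢ| d(xⱼ)`. -/
def crossExp : List (Cochain 𝒜) → ℤ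
  | [] => 0
  | y :: ys => y.1.2 * (bideg ys).1 + crossExp ys

variable [DirectSum.Decomposition 𝒜]

theorem component_isLinearMap (q : ℕ × ℤ) (l : List A) :
    IsLinearMap K (component (𝒜 := 𝒜) q l) :=
  isLinearMap_comp (fun x : HomBi 𝒜 q => evalList x.1 l) (fun v : TruncatedHochschild 𝒜 => v q)
    (evalList_isLinearMap q l) (DirectSum.component K (ℕ × ℤ) (fun p => HomBi 𝒜 p) q).isLinear

theorem crossExp_append (l₁ l₂ : List (Cochain 𝒜)) :
    crossExp (l₁ ++ l₂) = crossExp l₁ + crossExp l₂ + (bideg l₁).2 * (bideg l₂).1 := by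
  induction l₁ with
  | nil => simp [crossExp]
  | cons y l₁ ih =>
    simp only [List.cons_append, crossExp, ih, bideg_app, bideg_cons, Prod.fst_add, Prod.snd_add]
    push_cast; ring

theorem component_brace (x : Cochain 𝒜) (ys : List (Cochain 𝒜)) {q : ℕ × ℤ} {l : List A}
    (hl : l.length = q.1 + 1) :
    component q l (brace x ys) =
      if x.1 + bideg ys = q then substSum ys (evalList x.2.1) l else 0 := by
  refine (component_emb (braceC x ys) q l).trans ?_
  change (if x.1 + bideg ys = q then _ else _) = _
  split_ifs with h
  · exact evalList_braceC x ys (by rw [hl, ← h]; rfl)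
  · rfl

/-- The higher pre-Jacobi identity. -/
theorem brace_braceC (x : Cochain 𝒜) (ys zs : List (Cochain 𝒜)) :
    brace (braceC x ys) zs = mergeSum ys zs (brace x) := by
  refine eq_of_component fun q l hl => ?_
  have hlin := component_isLinearMap (𝒜 := 𝒜) q l
  have h₁ : component q l (mergeSum ys zs (brace x)) =
      mergeSum ys zs fun w => component q l (brace x w) := by
    refine (map_list_sum (IsLinearMap.mk' _ hlin) _).trans ?_
    simp only [IsLinearMap.mk'_apply, List.map_map, Function.comp_def,
      isLinearMap_map_sign (K := K) (B := TruncatedHochschild 𝒜) hlin, mergeSum]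
  rw [h₁, component_brace _ _ hl, mergeSum_congr (g := fun w =>
    if x.1 + bideg ys + bideg zs = q then substSum w (evalList x.2.1) l else 0) fun w hw _ => by
      rw [component_brace _ _ hl, hw, add_assoc]]
  change (if x.1 + bideg ys + bideg zs = q then _ else _) = _
  split_ifs with h
  · rw [← substSum_substSum _ _ (evalList_isMultilinear _)]
    refine substSum_congr _ _ fun w hw => evalList_braceC _ _ ?_
    rw [hl, ← h] at hw
    simp only [Prod.fst_add] at hw
    omega
  · simp [mergeSum]

/-- The `z`'s fall into three consecutive groups: before `y`, inside `y`, after `y`. Only the first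
group has to pass `y`. -/
theorem mergeSum_single_left {B : Type*} [AddCommGroup B] (y : Cochain 𝒜)
    (zs : List (Cochain 𝒜)) (f : List (Cochain 𝒜) → B) :
    mergeSum [y] zs f = ((splits zs).map fun t => ((splits t.2).map fun t' =>
      (koszul (bideg t.1) y.1).negOnePow • f (t.1 ++ braceC y t'.1 :: t'.2)).sum).sum := by
  induction zs generalizing f with
  | nil => simp [mergeSum_nil_right, splits, braceC_nil, koszul_comm 0]
  | cons z zs ih =>
    rw [mergeSum_cons_cons, ih, List.smul_sum, add_comm]
    simp only [sum_splits_cons, List.map_map, Function.comp_def, List.smul_sum, smul_smul,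
      ← Int.negOnePow_add, bideg_nil, bideg_cons, koszul_comm _ y.1, koszul_comm 0, koszul_add,
      koszul_zero, Int.negOnePow_zero, one_smul, mergeSum_nil_left, List.nil_append,
      List.cons_append, add_zero]

/-- A single `z` either stands between the `y`'s or is inserted into one of them. The latter sum is
written over `cuts` with `onSingle` so that it matches the sums over cuts in `composition`. -/
theorem mergeSum_single_right {B : Type*} [AddCommGroup B] (ys : List (Cochain 𝒜))
    (z : Cochain 𝒜) (f : List (Cochain 𝒜) → B) :
    mergeSum ys [z] f =
      ((splits ys).map fun t => (koszul (bideg t.2) z.1).negOnePow • f (t.1 ++ z :: t.2)).sum +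
      ((cuts ys).map fun t => onSingle (fun y =>
        (koszul (bideg t.2.2) z.1).negOnePow • f (t.1 ++ braceC y [z] :: t.2.2)) t.2.1).sum := by
  induction ys generalizing f with
  | nil => simp [mergeSum_nil_left, splits, cuts, koszul_comm 0]
  | cons y ys ih =>
    rw [mergeSum_cons_cons, sum_cuts_cons, sum_splits_onSingle
      (fun y d => (koszul (bideg d) z.1).negOnePow • f ([] ++ braceC y [z] :: d)),
      sum_splits_cons, sum_splits_nil, sum_splits_cons]
    simp only [mergeSum_nil_right, bideg_nil, koszul_zero, Int.negOnePow_zero, one_smul,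
      braceC_nil, ih, bideg_cons, add_zero, List.nil_append, List.cons_append]
    abel

/-- The brace `{x}{y₁, ..., yₙ}` with the sign that turns its signs into signs of total degrees. -/
def totalBrace (x : Cochain 𝒜) (ys : List (Cochain 𝒜)) : TruncatedHochschild 𝒜 :=
  (crossExp (x :: ys)).negOnePow • brace x ys

/-- The pre-Jacobi identity for a single `y`. Both sides carry their `crossExp`, and what remains is
the Koszul sign of moving the `z`'s in front of `y`, in total degrees. -/
theorem totalBrace_braceC_single (x y : Cochain 𝒜) (zs : List (Cochain 𝒜)) :
    (crossExp [x, y]).negOnePow • totalBrace (braceC x [y]) zs =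
      ((cuts zs).map fun t => (tot (bideg t.1) * tot y.1).negOnePow •
        (crossExp (y :: t.2.1)).negOnePow • totalBrace x (t.1 ++ braceC y t.2.1 :: t.2.2)).sum +
      ((splits zs).map fun t => (tot (bideg t.1) * tot y.1).negOnePow •
        totalBrace x (t.1 ++ y :: t.2)).sum := by
  -- A bare `y` is `{y}{}`, which makes these terms the case of an empty middle part in the sum over
  -- subdivisions.
  have h₀ : ((splits zs).map fun t => (tot (bideg t.1) * tot y.1).negOnePow •
        totalBrace x (t.1 ++ y :: t.2)) = (splits zs).map fun t =>
          (tot (bideg t.1) * tot y.1).negOnePow • (crossExp [y]).negOnePow •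
            totalBrace x (t.1 ++ braceC y [] :: t.2) := by
    simp [crossExp, braceC_nil]
  rw [h₀, ← sum_cuts_add_sum_splits fun b c d => (tot (bideg b) * tot y.1).negOnePow •
    (crossExp (y :: c)).negOnePow • totalBrace x (b ++ braceC y c :: d),
    totalBrace, brace_braceC, mergeSum_single_left]
  simp only [List.smul_sum, List.map_map, Function.comp_def]
  refine congrArg List.sum (List.map_congr_left fun t ht => congrArg List.sum
    (List.map_congr_left fun t' ht' => ?_))
  rw [← append_of_mem_splits ht, ← append_of_mem_splits ht']
  simp only [totalBrace, smul_smul, ← Int.negOnePow_add]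
  congr 1
  apply negOnePow_congr
  simp only [crossExp, crossExp_append, bideg_app, bideg_cons, bideg_nil, braceC_fst, Prod.fst_add,
    Prod.snd_add, tot, koszul, Prod.fst_zero, Prod.snd_zero]
  push_cast
  ring_nf
  reduce_mod_char

theorem totalBrace_single (x : Cochain 𝒜) (ys : List (Cochain 𝒜)) (z : Cochain 𝒜) :
    (crossExp (x :: ys)).negOnePow • totalBrace (braceC x ys) [z] =
      ((splits ys).map fun t => (tot (bideg t.2) * tot z.1).negOnePow •
        totalBrace x (t.1 ++ z :: t.2)).sum +
      ((cuts ys).map fun t => onSingle (fun y => (tot (bideg t.2.2) * tot z.1).negOnePow •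
        (crossExp [y, z]).negOnePow • totalBrace x (t.1 ++ braceC y [z] :: t.2.2)) t.2.1).sum := by
  rw [totalBrace, brace_braceC, mergeSum_single_right]
  simp only [smul_add, List.smul_sum, List.map_map, Function.comp_def]
  congr 1
  · refine congrArg List.sum (List.map_congr_left fun t ht => ?_)
    rw [← append_of_mem_splits ht]
    simp only [totalBrace, smul_smul, ← Int.negOnePow_add]
    congr 1
    apply negOnePow_congr
    simp only [crossExp, crossExp_append, bideg_app, bideg_cons, bideg_nil, braceC_fst,
      Prod.fst_add, Prod.snd_add, tot, koszul, Prod.fst_zero]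
    push_cast
    ring_nf
    reduce_mod_char
  · refine congrArg List.sum (List.map_congr_left fun t ht => ?_)
    have h := (append_of_mem_cuts ht).1
    rcases hc : t.2.1 with _ | ⟨y, _ | ⟨y', c⟩⟩
    · simp [onSingle]
    · rw [hc] at h
      rw [← h]
      simp only [onSingle, totalBrace, smul_smul, ← Int.negOnePow_add]
      congr 1
      apply negOnePow_congr
      simp only [crossExp, crossExp_append, bideg_app, bideg_cons, bideg_nil, braceC_fst,
        Prod.fst_add, Prod.snd_add, tot, koszul, Prod.fst_zero, Prod.snd_zero]
      push_cast
      ring_nf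
      reduce_mod_char
    · simp [onSingle]

end Total

/-! ### The master identity for short barred strings -/

section Strings

variable {V : Type*}

theorem wordDeg_append (l₁ l₂ : List (ℤ × V)) :
    wordDeg (l₁ ++ l₂) = wordDeg l₁ + wordDeg l₂ := by simp [wordDeg]

theorem wordDeg_cons (a : ℤ × V) (l : List (ℤ × V)) :
    wordDeg (a :: l) = (a.1 - 1) + wordDeg l := by simp [wordDeg]

@[simp] theorem wordDeg_nil : wordDeg ([] : List (ℤ × V)) = 0 := rfl

theorem tildeExp_append_cons (l₁ l₂ : List (ℤ × V)) (k : ℤ) (a b : V) :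
    tildeExp (l₁ ++ (k, a) :: l₂) = tildeExp (l₁ ++ (k, b) :: l₂) := by
  induction l₁ with
  | nil => rfl
  | cons c l₁ ih => simp [tildeExp, ih]

@[simp] theorem shuffle_nil_left (v : List (ℤ × V)) : shuffle [] v = [(0, v)] := by
  simp [shuffle]

@[simp] theorem shuffle_nil_right (u : List (ℤ × V)) : shuffle u [] = [(0, u)] := by
  cases u <;> simp [shuffle]

/-- Shuffling one letter into a word means choosing the place where it is inserted. -/
theorem shuffle_single (x : ℤ × V) (l : List (ℤ × V)) :
    shuffle [x] l = (splits l).map fun t => (wordDeg t.1 * (x.1 - 1), t.1 ++ x :: t.2) := by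
  induction l with
  | nil => simp [splits]
  | cons y l ih =>
    rw [shuffle, ih]
    simp only [shuffle_nil_left, splits, List.map_cons, List.map_nil, List.map_map,
      List.cons_append, List.nil_append, wordDeg_nil, zero_mul]
    congr 1
    refine List.map_congr_left fun t _ => ?_
    simp only [Function.comp_apply, wordDeg_cons, wordDeg_nil, List.cons_append]
    congr 1
    ring

theorem cuts_single {α : Type*} (a : α) : cuts [a] = [([], [a], [])] := rfl

theorem cuts_pair {α : Type*} (a b : α) :
    cuts [a, b] = [([], [a], [b]), ([], [a, b], []), ([a], [b], [])] := rfl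

end Strings

section Master

variable {K V B : Type*} [Field K] [AddCommGroup V] [Module K V] [AddCommGroup B] [Module K B]

/-- The value of an `n`-linear map on a word of `n` vectors. -/
def evalWord {n : ℕ} (x : MultilinearMap K (fun _ : Fin n => V) B) (l : List V) : B :=
  if h : l.length = n then x fun i => l.get (i.cast h.symm) else 0

theorem evalWord_isMultilinear {n : ℕ} (x : MultilinearMap K (fun _ : Fin n => V) B) :
    IsMultilinear K (evalWord x) := by
  intro l₁ l₂
  by_cases h : (l₁ ++ (0 : V) :: l₂).length = n
  · have hi : l₁.length < n := by simp at h; omega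
    have key : ∀ a, evalWord x (l₁ ++ a :: l₂) =
        x (Function.update (fun i => (l₁ ++ (0 : V) :: l₂).get (i.cast h.symm))
          ⟨l₁.length, hi⟩ a) := by
      intro a
      have h' : (l₁ ++ a :: l₂).length = n := by simpa using h
      rw [evalWord, dif_pos h']
      congr 1
      ext j
      simp only [Function.update_apply, List.get_eq_getElem, Fin.ext_iff, Fin.val_cast,
        List.getElem_append, List.getElem_cons]
      split_ifs <;> first | rfl | omega
    refine ⟨fun a b => ?_, fun c a => ?_⟩
    · simp only [key, MultilinearMap.map_update_add]
    · simp only [key, MultilinearMap.map_update_smul]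
  · have key : ∀ a, evalWord x (l₁ ++ a :: l₂) = 0 := fun a => by
      rw [evalWord, dif_neg (by simpa using h)]
    refine ⟨fun a b => ?_, fun c a => ?_⟩
    · simp only [key, add_zero]
    · simp only [key, smul_zero]

theorem PartitionedMaps.apply_eq (m : PartitionedMaps K V) (L : List (List V)) :
    m.apply L = evalWord (m (L.map List.length)) L.flatten := by
  rw [evalWord, dif_pos List.length_flatten]
  rfl

theorem PartitionedMaps.tilde_snd (m : PartitionedMaps K V) (s : List ℕ → ℤ)
    (L : List (List (ℤ × V))) :
    (m.tilde s L).2 = (tildeExp L.flatten).negOnePow •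
      evalWord (m (L.map List.length)) (L.flatten.map Prod.snd) := by
  have h : (L.map (List.map Prod.snd)).map List.length = L.map List.length := by
    simp [Function.comp_def]
  rw [PartitionedMaps.tilde, PartitionedMaps.apply_eq, h, ← List.map_flatten]

theorem PartitionedMaps.tilde_isLinearMap (m : PartitionedMaps K V) (s : List ℕ → ℤ)
    (P R : List (List (ℤ × V))) (b d : List (ℤ × V)) (k : ℤ) :
    IsLinearMap K fun a => (m.tilde s (P ++ (b ++ (k, a) :: d) :: R)).2 := by
  have h : ∀ a, (m.tilde s (P ++ (b ++ (k, a) :: d) :: R)).2 =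
      (tildeExp ((P.flatten ++ b) ++ (k, 0) :: (d ++ R.flatten))).negOnePow •
        evalWord (m (P.map List.length ++ (b.length + (d.length + 1)) :: R.map List.length))
          ((P.flatten ++ b).map Prod.snd ++ a :: (d ++ R.flatten).map Prod.snd) := fun a => by
    have h : (P ++ (b ++ (k, a) :: d) :: R).map List.length =
        P.map List.length ++ (b.length + (d.length + 1)) :: R.map List.length := by simp
    rw [tilde_snd, ← tildeExp_append_cons _ _ k a 0, h]
    simp
  simp only [h]
  exact isLinearMap_comp _ _ (isLinearMap_sign _) (evalWord_isMultilinear _ _ _)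

/-- The degree of the inner value depends only on the degrees and types of its arguments, not on
`a`; with it fixed, both maps are linear. -/
theorem PartitionedMaps.tilde_tilde_isLinearMap (m : PartitionedMaps K V) (s : List ℕ → ℤ)
    (P R : List (List (ℤ × V))) (b d : List (ℤ × V)) (P' R' : List (List (ℤ × V)))
    (b' d' : List (ℤ × V)) (k : ℤ) :
    IsLinearMap K fun a =>
      (m.tilde s (P ++ (b ++ m.tilde s (P' ++ (b' ++ (k, a) :: d') :: R') :: d) :: R)).2 := by
  have h : ∀ a, m.tilde s (P' ++ (b' ++ (k, a) :: d') :: R') =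
      ((m.tilde s (P' ++ (b' ++ (k, 0) :: d') :: R')).1,
        (m.tilde s (P' ++ (b' ++ (k, a) :: d') :: R')).2) := fun a => by
    refine Prod.ext ?_ rfl
    simp [PartitionedMaps.tilde]
  have h' : ∀ a, (m.tilde s (P ++ (b ++ m.tilde s (P' ++ (b' ++ (k, a) :: d') :: R') :: d) :: R)).2
      = (m.tilde s (P ++ (b ++ ((m.tilde s (P' ++ (b' ++ (k, 0) :: d') :: R')).1,
        (m.tilde s (P' ++ (b' ++ (k, a) :: d') :: R')).2) :: d) :: R)).2 := fun a => by
    rw [← h]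
  simp only [h']
  exact isLinearMap_comp (fun v => (m.tilde s (P ++ (b ++ (_, v) :: d) :: R)).2) _
    (m.tilde_isLinearMap s P R b d _) (m.tilde_isLinearMap s P' R' b' d' k)

theorem PartitionedMaps.composition_single (m : PartitionedMaps K V) (s : List ℕ → ℤ)
    (l : List (ℤ × V)) :
    m.composition s [l] = ((cuts l).map fun t => (wordDeg t.1).negOnePow •
      (m.tilde s [t.1 ++ m.tilde s [t.2.1] :: t.2.2]).2).sum := by
  simp [PartitionedMaps.composition, cuts_single, List.sections, shuffles, extractExp,
    Function.comp_def]

/-- The three sums correspond to the inner map using the first slot, both slots, or the second slot.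
Since the first slot has one letter, `x` is its whole middle part. The exponent `x.1 = ‖x‖ + 1`
accounts for `x` together with the bar. -/
theorem PartitionedMaps.composition_pair (m : PartitionedMaps K V) (s : List ℕ → ℤ)
    (x : ℤ × V) (l : List (ℤ × V)) :
    m.composition s [[x], l] =
      (m.tilde s [[m.tilde s [[x]]], l]).2 +
      (((cuts l).map fun t => (wordDeg t.1 * x.1 + wordDeg t.1).negOnePow •
        (m.tilde s [t.1 ++ m.tilde s [[x], t.2.1] :: t.2.2]).2).sum +
      ((cuts l).map fun t => (x.1 + wordDeg t.1).negOnePow •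
        (m.tilde s [[x], t.1 ++ m.tilde s [t.2.1] :: t.2.2]).2).sum) := by
  simp [PartitionedMaps.composition, cuts_single, cuts_pair, List.sections, shuffles, extractExp,
    Function.comp_def, ← List.map_eq_flatMap, wordDeg_cons, mul_add,
    add_comm (wordDeg _) (wordDeg _ * _)]

theorem PartitionedMaps.intertwine_single (m : PartitionedMaps K V) (s : List ℕ → ℤ)
    (l : List (ℤ × V)) : m.intertwine s [l] = 0 := by
  simp [PartitionedMaps.intertwine, cuts_single]

theorem PartitionedMaps.intertwine_pair (m : PartitionedMaps K V) (s : List ℕ → ℤ)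
    (x : ℤ × V) (l : List (ℤ × V)) :
    m.intertwine s [[x], l] = ((splits l).map fun t =>
      ((x.1 - 1) + wordDeg t.1 * (x.1 - 1)).negOnePow • (m.tilde s [t.1 ++ x :: t.2]).2).sum := by
  simp [PartitionedMaps.intertwine, cuts_pair, shuffle_single, wordDeg_cons, Function.comp_def]

/-! ### Functions of words of letters that are linear in each letter -/

/-- A function of words of letters that is linear in each letter, its degree being fixed. -/
def IsLetterLinear (K : Type*) [Field K] [Module K V] [Module K B] (Φ : List (ℤ × V) → B) : Prop :=
  ∀ (l₁ l₂ : List (ℤ × V)) (k : ℤ), IsLinearMap K fun a => Φ (l₁ ++ (k, a) :: l₂)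

theorem IsLetterLinear.cons {Φ : List (ℤ × V) → B} (h : IsLetterLinear K Φ) (z : ℤ × V) :
    IsLetterLinear K fun l => Φ (z :: l) := fun l₁ l₂ => h (z :: l₁) l₂

theorem IsLetterLinear.sum_splits {G : List (ℤ × V) → List (ℤ × V) → B}
    (h₁ : ∀ d, IsLetterLinear K fun c => G c d) (h₂ : ∀ c, IsLetterLinear K (G c)) :
    IsLetterLinear K fun l => ((splits l).map fun t => G t.1 t.2).sum := by
  intro l₁
  induction l₁ generalizing G with
  | nil =>
    intro l₂ k
    simp only [List.nil_append, sum_splits_cons]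
    exact isLinearMap_add _ _ (h₂ [] [] l₂ k)
      (isLinearMap_list_sum _ _ fun t _ => h₁ t.2 [] t.1 k)
  | cons z l₁ ih =>
    intro l₂ k
    simp only [List.cons_append, sum_splits_cons]
    exact isLinearMap_add _ _ (h₂ [] (z :: l₁) l₂ k)
      (ih (G := fun c => G (z :: c)) (fun d => (h₁ d).cons z) (fun c => h₂ (z :: c)) l₂ k)

theorem IsLetterLinear.sum_cuts {F : List (ℤ × V) → List (ℤ × V) → List (ℤ × V) → B}
    (h₁ : ∀ c d, IsLetterLinear K fun b => F b c d) (h₂ : ∀ b d, IsLetterLinear K fun c => F b c d)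
    (h₃ : ∀ b c, IsLetterLinear K (F b c)) :
    IsLetterLinear K fun l => ((cuts l).map fun t => F t.1 t.2.1 t.2.2).sum := by
  intro l₁
  induction l₁ generalizing F with
  | nil =>
    intro l₂ k
    simp only [List.nil_append, sum_cuts_cons]
    exact isLinearMap_add _ _ (isLinearMap_list_sum _ _ fun t _ => h₂ [] t.2 [] t.1 k)
      (isLinearMap_list_sum _ _ fun t _ => h₁ t.2.1 t.2.2 [] t.1 k)
  | cons z l₁ ih =>
    intro l₂ k
    simp only [List.cons_append, sum_cuts_cons]
    exact isLinearMap_add _ _ (IsLetterLinear.sum_splits (G := fun c d => F [] (z :: c) d)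
        (fun d => (h₂ [] d).cons z) (fun c => h₃ [] (z :: c)) l₁ l₂ k)
      (ih (F := fun b => F (z :: b)) (fun c d => (h₁ c d).cons z) (fun b => h₂ (z :: b))
        (fun b => h₃ (z :: b)) l₂ k)

/-- The sums over cuts in the composition are linear in each letter. -/
theorem PartitionedMaps.sum_cuts_isLetterLinear (m : PartitionedMaps K V) (s : List ℕ → ℤ)
    (P P' : List (List (ℤ × V))) (e e' : ℤ) :
    IsLetterLinear K fun l => ((cuts l).map fun t => (wordDeg t.1 * e + e').negOnePow •
      (m.tilde s (P ++ [t.1 ++ m.tilde s (P' ++ [t.2.1]) :: t.2.2])).2).sum := by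
  refine IsLetterLinear.sum_cuts (F := fun b c d => (wordDeg b * e + e').negOnePow •
    (m.tilde s (P ++ [b ++ m.tilde s (P' ++ [c]) :: d])).2) (fun c d l₁ l₂ k => ?_)
    (fun b d l₁ l₂ k => ?_) (fun b c l₁ l₂ k => ?_)
  · simp only [wordDeg_append, wordDeg_cons, List.append_assoc, List.cons_append]
    exact isLinearMap_comp _ _ (isLinearMap_sign _) (m.tilde_isLinearMap s P [] l₁ _ k)
  · exact isLinearMap_comp _ _ (isLinearMap_sign _)
      (m.tilde_tilde_isLinearMap s P [] b d P' [] l₁ l₂ k)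
  · have := m.tilde_isLinearMap s P [] (b ++ m.tilde s (P' ++ [c]) :: l₁) l₂ k
    simp only [List.append_assoc, List.cons_append] at this
    exact isLinearMap_comp _ _ (isLinearMap_sign _) this

theorem PartitionedMaps.master_single_isLetterLinear (m : PartitionedMaps K V) (s : List ℕ → ℤ) :
    IsLetterLinear K fun l => m.composition s [l] + m.intertwine s [l] := by
  simp only [composition_single, intertwine_single, add_zero]
  simpa using m.sum_cuts_isLetterLinear s [] [] 1 0

theorem PartitionedMaps.master_pair_isLinearMap (m : PartitionedMaps K V) (s : List ℕ → ℤ)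
    (l : List (ℤ × V)) (k : ℤ) :
    IsLinearMap K fun a => m.composition s [[(k, a)], l] + m.intertwine s [[(k, a)], l] := by
  simp only [composition_pair, intertwine_pair]
  refine isLinearMap_add _ _ (isLinearMap_add _ _ ?_ (isLinearMap_add _ _ ?_ ?_)) ?_
  · exact m.tilde_tilde_isLinearMap s [] [l] [] [] [] [] [] [] k
  · exact isLinearMap_list_sum _ _ fun t _ => isLinearMap_comp _ _ (isLinearMap_sign _)
      (m.tilde_tilde_isLinearMap s [] [] t.1 t.2.2 [] [t.2.1] [] [] k)
  · exact isLinearMap_list_sum _ _ fun t _ => isLinearMap_comp _ _ (isLinearMap_sign _)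
      (m.tilde_isLinearMap s [] _ [] [] k)
  · exact isLinearMap_list_sum _ _ fun t _ => isLinearMap_comp _ _ (isLinearMap_sign _)
      (m.tilde_isLinearMap s [] [] t.1 t.2 k)

theorem PartitionedMaps.master_pair_isLetterLinear (m : PartitionedMaps K V) (s : List ℕ → ℤ)
    (x : ℤ × V) :
    IsLetterLinear K fun l => m.composition s [[x], l] + m.intertwine s [[x], l] := by
  intro l₁ l₂ k
  simp only [composition_pair, intertwine_pair]
  refine isLinearMap_add _ _ (isLinearMap_add _ _ ?_ (isLinearMap_add _ _ ?_ ?_)) ?_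
  · exact m.tilde_isLinearMap s [[m.tilde s [[x]]]] [] l₁ l₂ k
  · have := m.sum_cuts_isLetterLinear s [] [[x]] (x.1 + 1) 0 l₁ l₂ k
    simpa [mul_add] using this
  · have := m.sum_cuts_isLetterLinear s [[x]] [] 1 x.1 l₁ l₂ k
    simpa [add_comm] using this
  · refine IsLetterLinear.sum_splits (G := fun b d =>
      ((x.1 - 1) + wordDeg b * (x.1 - 1)).negOnePow • (m.tilde s [b ++ x :: d]).2)
      (fun d l₁ l₂ k => ?_) (fun b l₁ l₂ k => ?_) l₁ l₂ k
    · simp only [wordDeg_append, wordDeg_cons, List.append_assoc, List.cons_append]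
      exact isLinearMap_comp _ _ (isLinearMap_sign _) (m.tilde_isLinearMap s [] [] l₁ _ k)
    · have := m.tilde_isLinearMap s [] [] (b ++ x :: l₁) l₂ k
      simp only [List.append_assoc, List.cons_append] at this
      exact isLinearMap_comp _ _ (isLinearMap_sign _) this

end Master

/-! ### The grading of the truncated Hochschild complex -/

section Grading

variable {K A : Type*} [Field K] [NonUnitalRing A] [Module K A] {𝒜 : ℤ → Submodule K A}

theorem coeAddMonoidHom_hochGrading_apply (f : ⨁ N, hochGrading 𝒜 N) (p : ℕ × ℤ) :
    (DirectSum.coeAddMonoidHom (hochGrading 𝒜) f) p =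
      (f ((p.1 : ℤ) + 1 + p.2) : TruncatedHochschild 𝒜) p := by
  induction f using DirectSum.induction_on with
  | zero => simp
  | of N x =>
    rw [DirectSum.coeAddMonoidHom_of]
    by_cases h : (p.1 : ℤ) + 1 + p.2 = N
    · subst h; rw [DirectSum.of_eq_same]
    · rw [DirectSum.of_eq_of_ne _ _ _ h, x.2 p h]; rfl
  | add f g hf hg =>
    rw [map_add, DirectSum.add_apply, DirectSum.add_apply, hf, hg]; rfl

theorem emb_mem (c : Cochain 𝒜) : emb c ∈ hochGrading 𝒜 (tot c.1 + 1) := by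
  intro p hp
  rw [emb, DirectSum.lof_eq_of, DirectSum.of_eq_of_ne]
  rintro rfl
  exact hp (by simp only [tot]; ring)

theorem eq_sum_emb (v : TruncatedHochschild 𝒜) :
    ∃ S : Finset (ℕ × ℤ), (∀ p ∈ S, v p ≠ 0) ∧ v = ∑ p ∈ S, emb ⟨p, v p⟩ := by
  classical
  exact ⟨DFinsupp.support v, fun p hp => DFinsupp.mem_support_iff.1 hp,
    (DirectSum.sum_support_of v).symm⟩

/-- The component of bidegree `(d, s)` sees only the summand of degree `d + 1 + s`, which gives
injectivity; surjectivity holds because each vector is a finite sum of homogeneous cochains. -/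
theorem hochGrading_isInternal : DirectSum.IsInternal (hochGrading 𝒜) := by
  constructor
  · intro f g h
    refine DFinsupp.ext fun N => Subtype.ext (DFinsupp.ext fun p => ?_)
    by_cases hp : (p.1 : ℤ) + 1 + p.2 = N
    · subst hp
      have := coeAddMonoidHom_hochGrading_apply f p
      rw [h, coeAddMonoidHom_hochGrading_apply g p] at this
      exact this.symm
    · exact ((f N).2 p hp).trans ((g N).2 p hp).symm
  · intro v
    obtain ⟨S, -, hS⟩ := eq_sum_emb v
    rw [hS]
    refine ⟨∑ p ∈ S, DirectSum.of (fun N => hochGrading 𝒜 N) _ ⟨_, emb_mem ⟨p, v p⟩⟩, ?_⟩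
    rw [map_sum]
    exact Finset.sum_congr rfl fun p _ => DirectSum.coeAddMonoidHom_of _ _ _

/-- The nonzero components of a vector of degree `k` are cochains of total degree `k`, possibly of
different bidegrees. -/
theorem mem_of_mem_hochGrading {B : Type*} [AddCommGroup B] [Module K B]
    {f : TruncatedHochschild 𝒜 → B} (hf : IsLinearMap K f) (W : Submodule K B) {k : ℤ}
    (h : ∀ c : Cochain 𝒜, tot c.1 + 1 = k → f (emb c) ∈ W) {v : TruncatedHochschild 𝒜}
    (hv : v ∈ hochGrading 𝒜 k) : f v ∈ W := by
  obtain ⟨S, hS, hv'⟩ := eq_sum_emb v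
  rw [hv', show f (∑ p ∈ S, emb ⟨p, v p⟩) = ∑ p ∈ S, f (emb ⟨p, v p⟩) from
    map_sum (IsLinearMap.mk' f hf) _ _]
  refine Submodule.sum_mem _ fun p hp => h _ ?_
  by_contra hk
  exact hS p hp (hv p fun e => hk (by rw [← e]; simp only [tot]; ring))

instance : AddSubgroupClass (Submodule K (TruncatedHochschild 𝒜)) (TruncatedHochschild 𝒜) :=
  Submodule.addSubgroupClass (R := K) (M := TruncatedHochschild 𝒜)

/-- A homogeneous cochain as a letter. -/
def letter (c : Cochain 𝒜) : ℤ × TruncatedHochschild 𝒜 := (tot c.1 + 1, emb c)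

/-- The sign of the structure maps is the sign of `m̃` times the factor `crossExp`; in `m̃` the
former cancels, leaving the sign of `totalBrace`. -/
theorem signExp_eq (ys : List (Cochain 𝒜)) :
    signExp (ys.map Sigma.fst) = tildeExp (ys.map letter) + crossExp ys := by
  induction ys with
  | nil => rfl
  | cons y ys ih =>
    simp only [List.map_cons, signExp, ih, tildeExp, crossExp, List.length_map, letter, tot, bideg]
    ring

/-- Letters are replaced by cochains from left to right while the degree of each letter is kept.
With `W = ⊥` this reduces identities to cochains, with `W` a graded piece it gives homogeneity of
the structure maps. -/
theorem IsLetterLinear.mem_of_homogeneous {B : Type*} [AddCommGroup B] [Module K B]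
    {Φ : List (ℤ × TruncatedHochschild 𝒜) → B} (hΦ : IsLetterLinear K Φ) (W : Submodule K B)
    (l : List (ℤ × TruncatedHochschild 𝒜)) (hl : ∀ a ∈ l, a.2 ∈ hochGrading 𝒜 a.1)
    (h : ∀ cs : List (Cochain 𝒜), (cs.map letter).map Prod.fst = l.map Prod.fst →
      Φ (cs.map letter) ∈ W) : Φ l ∈ W := by
  suffices H : ∀ (l₂ : List (ℤ × TruncatedHochschild 𝒜)) (cs : List (Cochain 𝒜)),
      (∀ a ∈ l₂, a.2 ∈ hochGrading 𝒜 a.1) →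
      (cs.map letter ++ l₂).map Prod.fst = l.map Prod.fst → Φ (cs.map letter ++ l₂) ∈ W from
    H l [] hl rfl
  intro l₂
  induction l₂ with
  | nil => intro cs _ hc; simpa using h cs (by simpa using hc)
  | cons a l₂ ih =>
    intro cs ha hc
    refine mem_of_mem_hochGrading (hΦ (cs.map letter) l₂ a.1) W (fun c hk => ?_)
      (ha a (by simp))
    have := ih (cs ++ [c]) (fun b hb => ha b (by simp [hb])) (by simpa [letter, hk] using hc)
    simpa [letter, hk] using this

end Grading

/-! ### Values on homogeneous cochains -/

section Values

variable {K A : Type*} [Field K] [NonUnitalRing A] [Module K A] {𝒜 : ℤ → Submodule K A}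
  [DirectSum.Decomposition 𝒜]

theorem wordDeg_letter (ys : List (Cochain 𝒜)) : wordDeg (ys.map letter) = tot (bideg ys) := by
  induction ys with
  | nil => simp
  | cons y ys ih => rw [List.map_cons, wordDeg_cons, ih, bideg_cons, tot_add]; simp [letter]

theorem sum_fst_letter (ys : List (Cochain 𝒜)) :
    ((ys.map letter).map Prod.fst).sum = tot (bideg ys) + ys.length := by
  induction ys with
  | nil => simp
  | cons y ys ih =>
    simp only [List.map_cons, List.sum_cons, ih, bideg_cons, tot_add, List.length_cons, letter]
    push_cast; ring

variable [IsScalarTower K A A] [SMulCommClass K A A] [SetLike.GradedMul 𝒜]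

theorem evalWord_hochMaps (π : List ℕ) (cs : List (Cochain 𝒜)) (h : cs.length = π.sum) :
    evalWord (hochMaps 𝒜 π) (cs.map emb) = structureMap 𝒜 π cs := by
  have h' : (cs.map emb).length = π.sum := by simpa using h
  rw [evalWord, dif_pos h']
  have e : (List.ofFn fun i : Fin π.sum => cs.get (i.cast h.symm)) = cs := by
    apply List.ext_getElem <;> simp [h]
  have := hochMaps_apply π fun i : Fin π.sum => cs.get (i.cast h.symm)
  rw [e] at this
  rw [← this]
  congr 1
  ext1 i
  simp [emb]

/-- The super degrees of the structure maps. -/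
def superDeg (π : List ℕ) : ℤ := 3 - π.length - π.sum

theorem structureMap_mem (π : List ℕ) (cs : List (Cochain 𝒜)) (h : cs.length = π.sum) :
    structureMap 𝒜 π cs ∈ hochGrading 𝒜 (tot (bideg cs) + cs.length + superDeg π) := by
  have hb : ∀ (x : Cochain 𝒜) (ys : List (Cochain 𝒜)) (N : ℤ), tot x.1 + tot (bideg ys) + 1 = N →
      brace x ys ∈ hochGrading 𝒜 N := fun x ys N hN => by
    have := emb_mem (braceC x ys)
    rwa [braceC_fst, tot_add, hN] at this
  have hs : ∀ (e : ℤ) {N : ℤ} {v : TruncatedHochschild 𝒜}, v ∈ hochGrading 𝒜 N →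
      e.negOnePow • v ∈ hochGrading 𝒜 N := fun e N v hv => zsmul_mem hv _
  have hm : tot (mulCochain 𝒜).1 = 1 := rfl
  unfold structureMap
  split
  · refine sub_mem (hb _ _ _ ?_) (hs _ (hb _ _ _ ?_))
    · simp [hm, superDeg, bideg_cons]; ring
    · simp [hm, superDeg, bideg_cons]
  · refine hs _ (hb _ _ _ ?_)
    simp [hm, superDeg, bideg_cons, tot_add]; ring
  · refine hs _ (hb _ _ _ ?_)
    simp at h
    simp [superDeg, bideg_cons, tot_add, h]; ring
  · rename_i x
    have := emb_mem x
    simpa [superDeg, bideg_cons, emb] using this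
  · rename_i x
    have := emb_mem x
    simpa [superDeg, bideg_cons, emb] using this
  · exact Submodule.zero_mem _

/-- The bilinear map `m` has room for only two cochains: the degree count leaves fewer letters than
three or more of them need. -/
theorem brace_mul_eq_zero {ys : List (Cochain 𝒜)} (h : 3 ≤ ys.length) :
    brace (mulCochain 𝒜) ys = 0 := by
  refine eq_of_component fun q l hl => ?_
  rw [component_brace _ _ hl]
  split_ifs with hq
  · rw [substSum_eq_zero]
    · simp [component, evalList]
    · rw [hl, ← hq, Prod.fst_add]
      change 1 + _ + 1 < _
      omega
  · simp [component, evalList]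

/-- On `(a, b, c)` the brace is `(ab)c - a(bc)`; the minus sign comes from interchanging `m`, of
bidegree `(1, 0)`, with `a`, of bidegree `d(a) = -1`. -/
theorem brace_mul_mul : brace (mulCochain 𝒜) [mulCochain 𝒜] = 0 := by
  refine eq_of_component fun q l hl => ?_
  rw [component_brace _ _ hl]
  split_ifs with hq
  · have hl' : l.length = 3 := by rw [hl, ← hq, bideg_cons, bideg_nil]; rfl
    obtain ⟨a, b, c, rfl⟩ := List.length_eq_three.1 hl'
    have hpass : ∀ a : A, pass 𝒜 (mulCochain 𝒜).1 a = -a := fun a => by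
      induction a using DirectSum.Decomposition.inductionOn 𝒜 with
      | zero => simp
      | homogeneous a => rw [pass_of_mem _ a.2]; simp [mulCochain]
      | add a b ha hb => rw [map_add, ha, hb, neg_add]
    have hm : ∀ a b : A, evalList (mulCochain 𝒜).2.1 [a, b] = a * b := fun a b => rfl
    have hd : (mulCochain 𝒜).1.1 = 1 := rfl
    have h₀ : component q [a, b, c] (0 : TruncatedHochschild 𝒜) = 0 :=
      (component_isLinearMap q _).map_zero
    simp [substSum_cons_cons, substSum_cons_nil, substSum_nil, hpass, hm, h₀, cutAt, hd,
      bideg_cons, pass_zero, mul_assoc]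
  · simp [component, evalList]

end Values

/-! ### Sums over splittings in which only one term survives -/

section Lists

variable {α β B : Type*}

theorem splits_map (f : α → β) (l : List α) :
    splits (l.map f) = (splits l).map fun t => (t.1.map f, t.2.map f) := by
  induction l with
  | nil => rfl
  | cons a l ih => simp [splits, ih]

theorem cuts_map (f : α → β) (l : List α) :
    cuts (l.map f) = (cuts l).map fun t => (t.1.map f, t.2.1.map f, t.2.2.map f) := by
  induction l with
  | nil => rfl
  | cons a l ih => simp [cuts_cons, splits_map, ih, Function.comp_def]

theorem sum_splits_eq_last [AddCommMonoid B] (G : List α → List α → B)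
    (h : ∀ c d, d ≠ [] → G c d = 0) (l : List α) :
    ((splits l).map fun t => G t.1 t.2).sum = G l [] := by
  induction l generalizing G with
  | nil => simp [splits]
  | cons a l ih =>
    rw [sum_splits_cons, ih (fun c => G (a :: c)) fun c => h (a :: c), h [] _ (by simp), zero_add]

theorem sum_cuts_eq_full [AddCommMonoid B] (F : List α → List α → List α → B)
    (h : ∀ b c d, b ≠ [] ∨ d ≠ [] → F b c d = 0) {l : List α} (hl : l ≠ []) :
    ((cuts l).map fun t => F t.1 t.2.1 t.2.2).sum = F [] l [] := by
  obtain ⟨a, l, rfl⟩ := List.exists_cons_of_ne_nil hl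
  rw [sum_cuts_cons, sum_splits_eq_last (fun c => F [] (a :: c)) fun c d hd => h _ _ _ (.inr hd),
    List.sum_eq_zero, add_zero]
  intro v hv
  obtain ⟨t, -, rfl⟩ := List.mem_map.1 hv
  exact h _ _ _ (.inl (by simp))

theorem onSingle_append [Zero B] (f : α → B) (b d : List α) (x : α) (h : b ≠ [] ∨ d ≠ []) :
    onSingle f (b ++ x :: d) = 0 := by
  rcases b with _ | ⟨y, _ | ⟨y', b⟩⟩ <;> rcases d with _ | ⟨z, d⟩ <;> simp_all [onSingle]

theorem onSingle_sign [AddCommGroup B] (e : ℤ) (f : α → B) (l : List α) :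
    e.negOnePow • onSingle f l = onSingle (fun y => e.negOnePow • f y) l := by
  unfold onSingle
  split <;> simp

theorem sum_map_sub [AddCommGroup B] (f g : α → B) (l : List α) :
    (l.map fun a => f a - g a).sum = (l.map f).sum - (l.map g).sum := by
  induction l with
  | nil => simp
  | cons a l ih => simp only [List.map_cons, List.sum_cons, ih]; abel

theorem neg_smul_sign [AddCommGroup B] (e : ℤ) (v : B) :
    -(e.negOnePow • v) = (e + 1).negOnePow • v := by
  rw [Int.negOnePow_succ, Units.neg_smul]

end Lists

/-! ### The master identity on homogeneous cochains -/

section Values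

variable {K A : Type*} [Field K] [NonUnitalRing A] [Module K A] {𝒜 : ℤ → Submodule K A}
  [IsScalarTower K A A] [SMulCommClass K A A] [SetLike.GradedMul 𝒜]

theorem tot_mul : tot (mulCochain 𝒜).1 = 1 := rfl

variable [DirectSum.Decomposition 𝒜]

/-- The maps `M̃` of the truncated Hochschild complex. -/
abbrev hochTilde (L : List (List (ℤ × TruncatedHochschild 𝒜))) : ℤ × TruncatedHochschild 𝒜 :=
  (hochMaps 𝒜).tilde superDeg L

theorem hochTilde_snd (Cs : List (List (Cochain 𝒜))) :
    (hochTilde (Cs.map (List.map letter))).2 = (tildeExp (Cs.flatten.map letter)).negOnePow •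
      structureMap 𝒜 (Cs.map List.length) Cs.flatten := by
  have h : (Cs.map (List.map letter)).map List.length = Cs.map List.length := by
    simp [Function.comp_def]
  have h' : (Cs.flatten.map letter).map Prod.snd = Cs.flatten.map emb := by
    simp [Function.comp_def, letter]
  rw [PartitionedMaps.tilde_snd, h, ← List.map_flatten, h',
    evalWord_hochMaps _ _ List.length_flatten]

theorem hochTilde_fst (Cs : List (List (Cochain 𝒜))) :
    (hochTilde (Cs.map (List.map letter))).1 = tot (bideg Cs.flatten) + 3 - Cs.length := by
  have h : (Cs.map (List.map letter)).map List.length = Cs.map List.length := by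
    simp [Function.comp_def]
  rw [hochTilde, PartitionedMaps.tilde, h, ← List.map_flatten, sum_fst_letter, superDeg,
    List.length_flatten, List.length_map]
  ring

theorem totalBrace_mul_eq_zero {ys : List (Cochain 𝒜)} (h : 3 ≤ ys.length) :
    totalBrace (mulCochain 𝒜) ys = 0 := by
  rw [totalBrace, brace_mul_eq_zero h, smul_zero]

/-- One formula for all lengths. A single `x` gives `[m, x]`, where the bracket sign `d(x)` is `‖x‖
+ |x|` modulo 2 and `|x|` is the `crossExp` of `{x}{m}`. Two letters give the product. From three
letters on both sides vanish. -/
theorem hochTilde_single {ws : List (Cochain 𝒜)} (h : ws ≠ []) :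
    (hochTilde [ws.map letter]).2 = totalBrace (mulCochain 𝒜) ws -
      onSingle (fun y => (tot y.1).negOnePow • totalBrace y [mulCochain 𝒜]) ws := by
  have h₀ := hochTilde_snd [ws]
  simp only [List.map_cons, List.map_nil, List.flatten_cons, List.flatten_nil, List.append_nil]
    at h₀
  rw [h₀]
  rcases ws with _ | ⟨x, _ | ⟨y, _ | ⟨z, ws⟩⟩⟩
  · simp at h
  · simp only [List.length_cons, List.length_nil, zero_add, structureMap, gerstenhaberBracket,
      onSingle, totalBrace, smul_smul, ← Int.negOnePow_add]
    have e₁ : (tildeExp ([x].map letter)) = 0 := by simp [tildeExp]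
    have e₂ : crossExp [mulCochain 𝒜, x] = 0 := by simp [crossExp, mulCochain]
    rw [e₁, e₂, Int.negOnePow_zero, one_smul, one_smul]
    congr 1
    congr 1
    apply negOnePow_congr
    simp only [crossExp, tot, bideg_cons, bideg_nil, add_zero, mulCochain, Prod.fst_zero]
    push_cast
    ring_nf
    reduce_mod_char
  · simp only [List.length_cons, List.length_nil, zero_add, structureMap, onSingle, sub_zero,
      totalBrace, smul_smul, ← Int.negOnePow_add, Nat.reduceAdd]
    congr 1
    apply negOnePow_congr
    have := signExp_eq [x, y]
    simp only [List.map_cons, List.map_nil] at this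
    rw [this]
    simp only [crossExp, List.map_cons, List.map_nil, mulCochain]
    push_cast
    ring_nf
    reduce_mod_char
  · rw [totalBrace_mul_eq_zero (by simp)]
    simp [structureMap, onSingle]

theorem hochTilde_pair (x : Cochain 𝒜) {ys : List (Cochain 𝒜)} (h : ys ≠ []) :
    (hochTilde [[letter x], ys.map letter]).2 = (tot x.1).negOnePow • totalBrace x ys := by
  have h₀ := hochTilde_snd [[x], ys]
  simp only [List.map_cons, List.map_nil, List.flatten_cons, List.flatten_nil, List.append_nil,
    List.cons_append, List.nil_append] at h₀
  rw [h₀]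
  obtain ⟨y, ys, rfl⟩ := List.exists_cons_of_ne_nil h
  simp only [List.length_cons, List.length_nil, zero_add, structureMap, totalBrace, smul_smul,
    ← Int.negOnePow_add]
  congr 1
  apply negOnePow_congr
  have := signExp_eq (x :: y :: ys)
  simp only [List.map_cons] at this
  simp only [List.map_cons, this, tot]
  push_cast
  ring_nf
  reduce_mod_char

variable (P R : List (List (ℤ × TruncatedHochschild 𝒜))) (b d : List (ℤ × TruncatedHochschild 𝒜))

/-- The cochains `{m}{c}` and, for `c = y`, `{y}{m}` have the same total degree `tot c + 1`. So the
inner value is a combination of letters of one fixed degree, and the outer map is linear in that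
place. -/
theorem hochTilde_inner_single {c : List (Cochain 𝒜)} (h : c ≠ []) :
    (hochTilde (P ++ (b ++ hochTilde [c.map letter] :: d) :: R)).2 =
      (crossExp (mulCochain 𝒜 :: c)).negOnePow •
        (hochTilde (P ++ (b ++ letter (braceC (mulCochain 𝒜) c) :: d) :: R)).2 -
      onSingle (fun y => (tot y.1 + crossExp [y, mulCochain 𝒜]).negOnePow •
        (hochTilde (P ++ (b ++ letter (braceC y [mulCochain 𝒜]) :: d) :: R)).2) c := by
  have h₁ := hochTilde_fst [c]
  have h₂ := hochTilde_single h
  simp only [List.map_cons, List.map_nil, List.flatten_cons, List.flatten_nil, List.append_nil,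
    List.length_cons, List.length_nil] at h₁
  have h₃ : hochTilde [c.map letter] = (tot (bideg c) + 1 + 1, totalBrace (mulCochain 𝒜) c -
      onSingle (fun y => (tot y.1).negOnePow • totalBrace y [mulCochain 𝒜]) c) :=
    Prod.ext (by rw [h₁]; push_cast; ring) h₂
  have hlin := (hochMaps 𝒜).tilde_isLinearMap superDeg P R b d (tot (bideg c) + 1 + 1)
  rw [h₃]
  refine (IsLinearMap.map_sub (R := K) (M := TruncatedHochschild 𝒜) (M₂ := TruncatedHochschild 𝒜)
    hlin _ _).trans ?_
  congr 1
  · refine (isLinearMap_map_sign (K := K) (B := TruncatedHochschild 𝒜)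
      (C := TruncatedHochschild 𝒜) hlin _ _).trans ?_
    rw [letter, braceC_fst, tot_add, tot_mul, add_comm 1]
    rfl
  · rcases c with _ | ⟨y, _ | ⟨y', c⟩⟩
    · simp at h
    · simp only [onSingle]
      rw [totalBrace, smul_smul, ← Int.negOnePow_add]
      refine (isLinearMap_map_sign (K := K) (B := TruncatedHochschild 𝒜)
      (C := TruncatedHochschild 𝒜) hlin _ _).trans ?_
      rw [letter, braceC_fst, tot_add, bideg_cons, bideg_nil, add_zero, bideg_cons, bideg_nil,
        add_zero, tot_mul]
      rfl
    · exact hlin.map_zero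

theorem hochTilde_inner_pair (x : Cochain 𝒜) {c : List (Cochain 𝒜)} (h : c ≠ []) :
    (hochTilde (P ++ (b ++ hochTilde [[letter x], c.map letter] :: d) :: R)).2 =
      (tot x.1 + crossExp (x :: c)).negOnePow •
        (hochTilde (P ++ (b ++ letter (braceC x c) :: d) :: R)).2 := by
  have h₁ := hochTilde_fst [[x], c]
  simp only [List.map_cons, List.map_nil, List.flatten_cons, List.flatten_nil, List.append_nil,
    List.length_cons, List.length_nil, List.cons_append, List.nil_append] at h₁
  have h₃ : hochTilde [[letter x], c.map letter] = (tot x.1 + tot (bideg c) + 1,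
      (tot x.1 + crossExp (x :: c)).negOnePow • brace x c) := by
    refine Prod.ext ?_ ?_
    · rw [h₁, bideg_cons, tot_add]; push_cast; ring
    · rw [hochTilde_pair x h, totalBrace, smul_smul, ← Int.negOnePow_add]
  have hlin := (hochMaps 𝒜).tilde_isLinearMap superDeg P R b d (tot x.1 + tot (bideg c) + 1)
  rw [h₃]
  refine (isLinearMap_map_sign (K := K) (B := TruncatedHochschild 𝒜)
      (C := TruncatedHochschild 𝒜) hlin _ _).trans ?_
  rw [letter, braceC_fst, tot_add]
  rfl

end Values

section Letters

variable {K A : Type*} [Field K] [NonUnitalRing A] [Module K A] {𝒜 : ℤ → Submodule K A}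

theorem map_letter_append_cons (b d : List (Cochain 𝒜)) (c : Cochain 𝒜) :
    b.map letter ++ letter c :: d.map letter = (b ++ c :: d).map letter := by simp

end Letters

/-! ### Vanishing and cancellation for strings with one or two slots -/

section MasterValues

variable {K A : Type*} [Field K] [NonUnitalRing A] [Module K A] {𝒜 : ℤ → Submodule K A}
  [DirectSum.Decomposition 𝒜] [IsScalarTower K A A] [SMulCommClass K A A] [SetLike.GradedMul 𝒜]

theorem emb_braceC_mul_mul : emb (braceC (mulCochain 𝒜) [mulCochain 𝒜]) = 0 := brace_mul_mul

/-- By associativity the cochain `{m}{m}` itself is zero, and braces are linear in their first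
entry. -/
theorem totalBrace_mul_mul (ys : List (Cochain 𝒜)) :
    totalBrace (braceC (mulCochain 𝒜) [mulCochain 𝒜]) ys = 0 := by
  have h := DirectSum.of_injective (β := fun p : ℕ × ℤ => HomBi 𝒜 p) _
    ((emb_braceC_mul_mul (𝒜 := 𝒜)).trans (map_zero _).symm)
  have h' := (brace_isLinearMap_left (𝒜 := 𝒜) (K := K) ys
    (braceC (mulCochain 𝒜) [mulCochain 𝒜]).1).map_zero
  rw [← h] at h'
  rw [totalBrace]
  exact (congrArg _ h').trans (smul_zero _)

/-- By pre-Jacobi, `{{y}{m}}{m}` consists of `{y}{m, m}` twice, with opposite signs because `m` has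
odd total degree, and of `{y}{{m}{m}} = 0`. -/
theorem totalBrace_braceC_mul_mul (y : Cochain 𝒜) :
    totalBrace (braceC y [mulCochain 𝒜]) [mulCochain 𝒜] = 0 := by
  have h := DirectSum.of_injective (β := fun p : ℕ × ℤ => HomBi 𝒜 p) _
    ((emb_braceC_mul_mul (𝒜 := 𝒜)).trans (map_zero _).symm)
  have h' := (brace_isMultilinear_right (K := K) (𝒜 := 𝒜) y [] []
    (braceC (mulCochain 𝒜) [mulCochain 𝒜]).1).map_zero
  rw [← h] at h'
  have h₀ : totalBrace y [braceC (mulCochain 𝒜) [mulCochain 𝒜]] = 0 := by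
    rw [totalBrace]
    exact (congrArg _ h').trans (smul_zero _)
  have := totalBrace_single y [mulCochain 𝒜] (mulCochain 𝒜)
  simp only [splits, cuts_single, List.map_cons, List.map_nil, List.sum_cons, List.sum_nil,
    onSingle, List.nil_append, h₀, smul_zero, bideg_cons, bideg_nil, tot_mul, tot_zero, add_zero,
    List.cons_append] at this
  rw [← smul_eq_zero_iff_eq (crossExp [y, mulCochain 𝒜]).negOnePow, this]
  simp

theorem totalBrace_braceC_mul (x : Cochain 𝒜) (ys : List (Cochain 𝒜)) :
    (crossExp [x, mulCochain 𝒜]).negOnePow • totalBrace (braceC x [mulCochain 𝒜]) ys =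
      ((cuts ys).map fun t => (tot (bideg t.1)).negOnePow •
        (crossExp (mulCochain 𝒜 :: t.2.1)).negOnePow •
          totalBrace x (t.1 ++ braceC (mulCochain 𝒜) t.2.1 :: t.2.2)).sum +
      ((splits ys).map fun t => (tot (bideg t.1)).negOnePow •
        totalBrace x (t.1 ++ mulCochain 𝒜 :: t.2)).sum := by
  simpa only [tot_mul, mul_one] using totalBrace_braceC_single x (mulCochain 𝒜) ys

/-- The extra factor `(-1)^‖ys‖` turns signs counted from the cochains to the right of `m` into
signs counted from those to its left, as in `composition`. -/
theorem totalBrace_mul_right (x : Cochain 𝒜) (ys : List (Cochain 𝒜)) :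
    (tot (bideg ys)).negOnePow • (crossExp (x :: ys)).negOnePow •
        totalBrace (braceC x ys) [mulCochain 𝒜] =
      ((splits ys).map fun t => (tot (bideg t.1)).negOnePow •
        totalBrace x (t.1 ++ mulCochain 𝒜 :: t.2)).sum +
      ((cuts ys).map fun t => onSingle (fun y => (tot (bideg t.1) + tot y.1).negOnePow •
        (crossExp [y, mulCochain 𝒜]).negOnePow •
          totalBrace x (t.1 ++ braceC y [mulCochain 𝒜] :: t.2.2)) t.2.1).sum := by
  rw [totalBrace_single, smul_add, List.smul_sum, List.smul_sum, List.map_map, List.map_map]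
  congr 1
  · refine congrArg List.sum (List.map_congr_left fun t ht => ?_)
    rw [Function.comp_apply, smul_smul, ← Int.negOnePow_add, ← append_of_mem_splits ht]
    congr 1
    apply negOnePow_congr
    simp only [bideg_app, tot_add, tot_mul]
    push_cast
    ring_nf
    reduce_mod_char
  · refine congrArg List.sum (List.map_congr_left fun t ht => ?_)
    have h := (append_of_mem_cuts ht).1
    rw [Function.comp_apply]
    rcases hc : t.2.1 with _ | ⟨y, _ | ⟨y', c⟩⟩
    · simp [onSingle]
    · rw [hc] at h
      simp only [onSingle]
      rw [smul_smul, ← Int.negOnePow_add, ← h]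
      congr 1
      apply negOnePow_congr
      simp only [bideg_app, bideg_cons, bideg_nil, tot_add, tot_mul, tot_zero]
      push_cast
      ring_nf
      reduce_mod_char
    · simp [onSingle]

/-- The unary correction is absent: either the word has further letters, or it is `{{y}{m}}{m} = 0`.
-/
theorem hochTilde_braceC_mul (b d : List (Cochain 𝒜)) (y : Cochain 𝒜) :
    (hochTilde [(b ++ braceC y [mulCochain 𝒜] :: d).map letter]).2 =
      totalBrace (mulCochain 𝒜) (b ++ braceC y [mulCochain 𝒜] :: d) := by
  rw [hochTilde_single (by simp)]
  by_cases h : b ≠ [] ∨ d ≠ []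
  · rw [onSingle_append _ _ _ _ h, sub_zero]
  · push Not at h
    obtain ⟨rfl, rfl⟩ := h
    simp [onSingle, totalBrace_braceC_mul_mul]

/-- The compositions give the terms `{m}{b, {m}{c}, d}`, minus the terms `{m}{b, {y}{m}, d}`, plus
corrections summing to `{{m}{ys}}{m}` up to sign. Expanding the latter cancels the second family and
adds `{m}{b, m, d}`; the remaining sum is `{{m}{m}}{ys}`. -/
theorem composition_single_letter {ys : List (Cochain 𝒜)} (hys : ys ≠ []) :
    (hochMaps 𝒜).composition superDeg [ys.map letter] = 0 := by
  rw [PartitionedMaps.composition_single, cuts_map, List.map_map]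
  -- The part `{y}{m}` of the outer commutator; it is nonzero only if the outer map has one
  -- argument, that is, for `b` and `d` empty.
  let E : List (Cochain 𝒜) → List (Cochain 𝒜) → List (Cochain 𝒜) → TruncatedHochschild 𝒜 :=
    fun b c d => -((tot (bideg b)).negOnePow • (crossExp (mulCochain 𝒜 :: c)).negOnePow •
      onSingle (fun y => (tot y.1).negOnePow • totalBrace y [mulCochain 𝒜])
        (b ++ braceC (mulCochain 𝒜) c :: d))
  have hterm : ∀ t ∈ cuts ys, (wordDeg (t.1.map letter)).negOnePow •
      (hochTilde [t.1.map letter ++ hochTilde [t.2.1.map letter] :: t.2.2.map letter]).2 =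
      (tot (bideg t.1)).negOnePow • (crossExp (mulCochain 𝒜 :: t.2.1)).negOnePow •
        totalBrace (mulCochain 𝒜) (t.1 ++ braceC (mulCochain 𝒜) t.2.1 :: t.2.2) -
      onSingle (fun y => (tot (bideg t.1) + tot y.1).negOnePow •
        (crossExp [y, mulCochain 𝒜]).negOnePow •
          totalBrace (mulCochain 𝒜) (t.1 ++ braceC y [mulCochain 𝒜] :: t.2.2)) t.2.1 +
      E t.1 t.2.1 t.2.2 := by
    intro t ht
    have h := hochTilde_inner_single [] [] (t.1.map letter) (t.2.2.map letter)
      (append_of_mem_cuts ht).2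
    simp only [List.nil_append, map_letter_append_cons, hochTilde_braceC_mul] at h
    rw [h, hochTilde_single (by simp), wordDeg_letter]
    simp only [smul_sub, onSingle_sign, Int.negOnePow_add, mul_smul, E]
    abel
  have hE : ((cuts ys).map fun t => E t.1 t.2.1 t.2.2).sum =
      (tot (bideg ys)).negOnePow • (crossExp (mulCochain 𝒜 :: ys)).negOnePow •
        totalBrace (braceC (mulCochain 𝒜) ys) [mulCochain 𝒜] := by
    rw [sum_cuts_eq_full E (fun b c d h => ?_) hys]
    · simp only [E, List.nil_append, onSingle, bideg_nil, tot_zero, braceC_fst, tot_add, tot_mul,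
        smul_smul, ← Int.negOnePow_add]
      refine (neg_smul_sign (B := TruncatedHochschild 𝒜) _ _).trans ?_
      congr 1
      apply negOnePow_congr
      push_cast
      ring_nf
      reduce_mod_char
    · simp only [E]
      rw [onSingle_append _ _ _ _ h]
      simp
  refine (congrArg List.sum (List.map_congr_left hterm)).trans ?_
  have h₁ := totalBrace_braceC_mul (mulCochain 𝒜) ys
  rw [totalBrace_mul_mul, smul_zero] at h₁
  rw [List.sum_map_add, hE, totalBrace_mul_right, sum_map_sub]
  refine Eq.trans ?_ h₁.symm
  abel

/-- The differential of `x` gives `F₁, F₂, G₁, G₂` by expanding `{{m}{x}}{ys}` and `{{x}{m}}{ys}`.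
The inner maps `m̃(x|c)` cancel `F₁` and give `-(G₂ + H)`, the maps inside the second slot give `H -
G₁`, and the removed bar cancels `F₂`. -/
theorem composition_pair_letter (x : Cochain 𝒜) {ys : List (Cochain 𝒜)} (hys : ys ≠ []) :
    (hochMaps 𝒜).composition superDeg [[letter x], ys.map letter] +
      (hochMaps 𝒜).intertwine superDeg [[letter x], ys.map letter] = 0 := by
  rw [PartitionedMaps.composition_pair, PartitionedMaps.intertwine_pair, cuts_map, splits_map,
    List.map_map, List.map_map, List.map_map]
  let F₁ : List (Cochain 𝒜) × List (Cochain 𝒜) × List (Cochain 𝒜) → TruncatedHochschild 𝒜 :=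
    fun t => (tot (bideg t.1) * tot x.1).negOnePow • (crossExp (x :: t.2.1)).negOnePow •
      totalBrace (mulCochain 𝒜) (t.1 ++ braceC x t.2.1 :: t.2.2)
  let F₂ : List (Cochain 𝒜) × List (Cochain 𝒜) → TruncatedHochschild 𝒜 :=
    fun t => (tot (bideg t.1) * tot x.1).negOnePow •
      totalBrace (mulCochain 𝒜) (t.1 ++ x :: t.2)
  let G₁ : List (Cochain 𝒜) × List (Cochain 𝒜) × List (Cochain 𝒜) → TruncatedHochschild 𝒜 :=
    fun t => (tot (bideg t.1)).negOnePow • (crossExp (mulCochain 𝒜 :: t.2.1)).negOnePow •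
      totalBrace x (t.1 ++ braceC (mulCochain 𝒜) t.2.1 :: t.2.2)
  let G₂ : List (Cochain 𝒜) × List (Cochain 𝒜) → TruncatedHochschild 𝒜 :=
    fun t => (tot (bideg t.1)).negOnePow • totalBrace x (t.1 ++ mulCochain 𝒜 :: t.2)
  let H : List (Cochain 𝒜) × List (Cochain 𝒜) × List (Cochain 𝒜) → TruncatedHochschild 𝒜 :=
    fun t => onSingle (fun y => (tot (bideg t.1) + tot y.1).negOnePow •
      (crossExp [y, mulCochain 𝒜]).negOnePow •
        totalBrace x (t.1 ++ braceC y [mulCochain 𝒜] :: t.2.2)) t.2.1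
  let E : List (Cochain 𝒜) → List (Cochain 𝒜) → List (Cochain 𝒜) → TruncatedHochschild 𝒜 :=
    fun b c d => -((tot (bideg b) * tot x.1 + tot x.1 + crossExp (x :: c)).negOnePow •
      onSingle (fun y => (tot y.1).negOnePow • totalBrace y [mulCochain 𝒜])
        (b ++ braceC x c :: d))
  -- the differential of `x`
  have h₁ : (hochTilde [[hochTilde [[letter x]]], ys.map letter]).2 =
      (tot x.1 + 1).negOnePow • (((cuts ys).map F₁).sum + ((splits ys).map F₂).sum) +
        (((cuts ys).map G₁).sum + ((splits ys).map G₂).sum) := by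
    have h := hochTilde_inner_single [] [ys.map letter] [] [] (c := [x]) (by simp)
    simp only [List.nil_append, List.map_cons, List.map_nil, onSingle, hochTilde_pair _ hys,
      braceC_fst, bideg_cons, bideg_nil, add_zero, tot_add, tot_mul] at h
    rw [h, ← totalBrace_braceC_single, ← totalBrace_braceC_mul, sub_eq_add_neg]
    congr 1
    · simp only [smul_smul, ← Int.negOnePow_add]
      congr 2
      ring
    · simp only [smul_smul, ← Int.negOnePow_add]
      refine (neg_smul_sign (B := TruncatedHochschild 𝒜) _ _).trans ?_
      congr 1
      apply negOnePow_congr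
      push_cast
      ring_nf
      reduce_mod_char
  -- the differential and the products of the values of `x`
  have h₂ : ∀ t ∈ cuts ys,
      (wordDeg (t.1.map letter) * (letter x).1 + wordDeg (t.1.map letter)).negOnePow •
        (hochTilde [t.1.map letter ++
          hochTilde [[letter x], t.2.1.map letter] :: t.2.2.map letter]).2 =
      (tot x.1).negOnePow • F₁ t + E t.1 t.2.1 t.2.2 := by
    intro t ht
    have h := hochTilde_inner_pair [] [] (t.1.map letter) (t.2.2.map letter) x
      (append_of_mem_cuts ht).2
    simp only [List.nil_append, map_letter_append_cons] at h
    rw [h, hochTilde_single (by simp), wordDeg_letter, letter]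
    simp only [smul_sub, smul_smul, ← Int.negOnePow_add, F₁, E]
    rw [sub_eq_add_neg]
    congr 1
    · congr 1
      apply negOnePow_congr
      push_cast
      ring_nf
      reduce_mod_char
    · congr 2
      apply negOnePow_congr
      push_cast
      ring_nf
      reduce_mod_char
  -- Only the cut with empty `b` and `d` contributes; it is `{{x}{ys}}{m}` up to sign, which the
  -- pre-Jacobi identity expands.
  have hE : ((cuts ys).map fun t => E t.1 t.2.1 t.2.2).sum =
      -(((splits ys).map G₂).sum + ((cuts ys).map H).sum) := by
    rw [sum_cuts_eq_full E (fun b c d h => ?_) hys, ← totalBrace_mul_right]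
    · simp only [E, List.nil_append, onSingle, bideg_nil, tot_zero, braceC_fst, tot_add,
        smul_smul, ← Int.negOnePow_add]
      congr 2
      apply negOnePow_congr
      push_cast
      ring_nf
      reduce_mod_char
    · simp only [E]
      rw [onSingle_append _ _ _ _ h]
      simp
  -- the differentials and products of the arguments of `x`
  have h₃ : ∀ t ∈ cuts ys, ((letter x).1 + wordDeg (t.1.map letter)).negOnePow •
      (hochTilde [[letter x],
        t.1.map letter ++ hochTilde [t.2.1.map letter] :: t.2.2.map letter]).2 = H t - G₁ t := by
    intro t ht
    have h := hochTilde_inner_single [[letter x]] [] (t.1.map letter) (t.2.2.map letter)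
      (append_of_mem_cuts ht).2
    simp only [List.cons_append, List.nil_append, map_letter_append_cons] at h
    simp only [hochTilde_pair x (List.append_ne_nil_of_right_ne_nil _ (List.cons_ne_nil _ _))] at h
    rw [h, wordDeg_letter, letter, smul_sub, sub_eq_add_neg, onSingle_sign]
    refine Eq.trans ?_ (sub_eq_neg_add (α := TruncatedHochschild 𝒜) _ _).symm
    simp only [smul_smul, ← Int.negOnePow_add, H, G₁]
    congr 1
    · refine Eq.trans ?_ (neg_smul_sign (B := TruncatedHochschild 𝒜) _ _).symm
      congr 1
      apply negOnePow_congr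
      push_cast
      ring_nf
      reduce_mod_char
    · rcases t.2.1 with _ | ⟨y, _ | ⟨y', c⟩⟩
      · simp [onSingle]
      · refine (neg_smul_sign (B := TruncatedHochschild 𝒜) _ _).trans ?_
        simp only [onSingle]
        congr 1
        apply negOnePow_congr
        push_cast
        ring_nf
        reduce_mod_char
      · simp [onSingle]
  -- the bar is removed
  have h₄ : ∀ t ∈ splits ys, (((letter x).1 - 1) +
      wordDeg (t.1.map letter) * ((letter x).1 - 1)).negOnePow •
        (hochTilde [t.1.map letter ++ letter x :: t.2.map letter]).2 =
      (tot x.1).negOnePow • F₂ t := by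
    intro t ht
    -- As `ys` is nonempty, the word with `x` inserted has at least two letters, so the outer map
    -- has no unary correction.
    have hne : t.1 ≠ [] ∨ t.2 ≠ [] := by
      by_contra! h
      rw [← append_of_mem_splits ht, h.1, h.2] at hys
      exact hys rfl
    rw [map_letter_append_cons, hochTilde_single (by simp), onSingle_append _ _ _ _ hne, sub_zero,
      wordDeg_letter, letter]
    simp only [F₂, smul_smul, ← Int.negOnePow_add]
    congr 2
    ring
  have h₂' := congrArg List.sum (List.map_congr_left h₂)
  have h₃' := congrArg List.sum (List.map_congr_left h₃)
  have h₄' := congrArg List.sum (List.map_congr_left h₄)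
  rw [List.sum_map_add, hE] at h₂'
  rw [sum_map_sub] at h₃'
  refine (congrArg₂ (· + ·) (congrArg₂ (· + ·) h₁ (congrArg₂ (· + ·) h₂' h₃')) h₄').trans ?_
  have e₁ : ((cuts ys).map fun t => (tot x.1).negOnePow • F₁ t).sum =
      (tot x.1).negOnePow • ((cuts ys).map F₁).sum := by
    simp only [List.smul_sum, List.map_map, Function.comp_def]
  have e₂ : ((splits ys).map fun t => (tot x.1).negOnePow • F₂ t).sum =
      (tot x.1).negOnePow • ((splits ys).map F₂).sum := by
    simp only [List.smul_sum, List.map_map, Function.comp_def]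
  rw [e₁, e₂, Int.negOnePow_succ, Units.neg_smul, smul_add]
  abel

end MasterValues

/-! ### The truncated Hochschild complex is a homotopy Gerstenhaber algebra -/

section Main

variable {K A : Type*} [Field K] [NonUnitalRing A] [Module K A] {𝒜 : ℤ → Submodule K A}

theorem eq_self_of_emb {f : TruncatedHochschild 𝒜 → TruncatedHochschild 𝒜} (hf : IsLinearMap K f)
    (h : ∀ c, f (emb c) = emb c) (v : TruncatedHochschild 𝒜) : f v = v := by
  obtain ⟨S, -, hv⟩ := eq_sum_emb v
  rw [hv, show f (∑ p ∈ S, emb ⟨p, v p⟩) = ∑ p ∈ S, f (emb ⟨p, v p⟩) from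
    map_sum (IsLinearMap.mk' f hf) _ _]
  exact Finset.sum_congr rfl fun p _ => h _

theorem evalWord_ofFn {V B : Type*} [AddCommGroup V] [Module K V] [AddCommGroup B] [Module K B]
    {n : ℕ} (x : MultilinearMap K (fun _ : Fin n => V) B) (a : Fin n → V) :
    evalWord x (List.ofFn a) = x a := by
  simp [evalWord]

theorem eq_zero_of_mem_hochGrading {B : Type*} [AddCommGroup B] [Module K B]
    {f : TruncatedHochschild 𝒜 → B} (hf : IsLinearMap K f) {k : ℤ}
    (h : ∀ c : Cochain 𝒜, tot c.1 + 1 = k → f (emb c) = 0) {v : TruncatedHochschild 𝒜}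
    (hv : v ∈ hochGrading 𝒜 k) : f v = 0 :=
  (Submodule.mem_bot K).1 (mem_of_mem_hochGrading hf ⊥
    (fun c hc => (Submodule.mem_bot K).2 (h c hc)) hv)

theorem IsLetterLinear.eq_zero_of_homogeneous {B : Type*} [AddCommGroup B] [Module K B]
    {Φ : List (ℤ × TruncatedHochschild 𝒜) → B} (hΦ : IsLetterLinear K Φ)
    {l : List (ℤ × TruncatedHochschild 𝒜)} (hl : ∀ a ∈ l, a.2 ∈ hochGrading 𝒜 a.1) (hne : l ≠ [])
    (h : ∀ cs : List (Cochain 𝒜), cs ≠ [] → Φ (cs.map letter) = 0) : Φ l = 0 :=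
  (Submodule.mem_bot K).1 (hΦ.mem_of_homogeneous ⊥ l hl fun cs hcs =>
    (Submodule.mem_bot K).2 (h cs (by rintro rfl; exact hne (by simpa using hcs.symm))))

theorem PartitionedMaps.master_single_of_letter (m : PartitionedMaps K (TruncatedHochschild 𝒜))
    (s : List ℕ → ℤ) (h : ∀ cs : List (Cochain 𝒜), cs ≠ [] →
      m.composition s [cs.map letter] + m.intertwine s [cs.map letter] = 0)
    {l : List (ℤ × TruncatedHochschild 𝒜)} (hl : l ≠ [])
    (ha : ∀ a ∈ l, a.2 ∈ hochGrading 𝒜 a.1) :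
    m.composition s [l] + m.intertwine s [l] = 0 := by
  have h₁ := PartitionedMaps.master_single_isLetterLinear (V := TruncatedHochschild 𝒜) m s
  have h₂ := h₁.eq_zero_of_homogeneous ha hl
  exact h₂ h

/-- The second slot is reduced to cochains first, with `x` still arbitrary; then `x` is decomposed
with that slot fixed. -/
theorem PartitionedMaps.master_pair_of_letter (m : PartitionedMaps K (TruncatedHochschild 𝒜))
    (s : List ℕ → ℤ) (h : ∀ (c : Cochain 𝒜) (cs : List (Cochain 𝒜)), cs ≠ [] →
      m.composition s [[letter c], cs.map letter] + m.intertwine s [[letter c], cs.map letter] = 0)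
    {x : ℤ × TruncatedHochschild 𝒜} {l : List (ℤ × TruncatedHochschild 𝒜)} (hl : l ≠ [])
    (hx : x.2 ∈ hochGrading 𝒜 x.1) (ha : ∀ a ∈ l, a.2 ∈ hochGrading 𝒜 a.1) :
    m.composition s [[x], l] + m.intertwine s [[x], l] = 0 := by
  have h₁ := PartitionedMaps.master_pair_isLetterLinear (V := TruncatedHochschild 𝒜) m s x
  have h₂ := h₁.eq_zero_of_homogeneous ha hl
  refine h₂ fun cs hcs => ?_
  have h₃ := PartitionedMaps.master_pair_isLinearMap (V := TruncatedHochschild 𝒜) m s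
    (cs.map letter) x.1
  have h₄ := eq_zero_of_mem_hochGrading (B := TruncatedHochschild 𝒜) h₃ (k := x.1)
  refine h₄ (fun c hc => ?_) hx
  rw [← hc]
  exact h c cs hcs

variable [DirectSum.Decomposition 𝒜] [IsScalarTower K A A] [SMulCommClass K A A]
  [SetLike.GradedMul 𝒜]

theorem hochMaps_eq_zero {π : List ℕ} (h : ∀ cs, structureMap 𝒜 π cs = 0) :
    hochMaps 𝒜 π = 0 := by
  rw [hochMaps, ← map_zero MultilinearMap.fromDirectSumEquiv]
  congr 1
  funext p
  exact MultilinearMap.ext fun x => h _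

theorem evalWord_hochMaps_isMultilinear (π : List ℕ) :
    IsMultilinear K (evalWord (V := TruncatedHochschild 𝒜) (B := TruncatedHochschild 𝒜)
      (hochMaps 𝒜 π)) :=
  evalWord_isMultilinear (V := TruncatedHochschild 𝒜) (B := TruncatedHochschild 𝒜) _

theorem hochMaps_apply_single {L : List (List (TruncatedHochschild 𝒜))} {c : Cochain 𝒜}
    (hL : L.flatten = [emb c]) (h : structureMap 𝒜 (L.map List.length) [c] = emb c) :
    (hochMaps 𝒜).apply L = emb c := by
  rw [PartitionedMaps.apply_eq, hL]
  refine (evalWord_hochMaps _ [c] ?_).trans h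
  rw [← List.length_flatten, hL]
  rfl

theorem hochMaps_mem (π : List ℕ) (k : Fin π.sum → ℤ) (a : Fin π.sum → TruncatedHochschild 𝒜)
    (ha : ∀ i, a i ∈ hochGrading 𝒜 (k i)) :
    hochMaps 𝒜 π a ∈ hochGrading 𝒜 (∑ i, k i + superDeg π) := by
  have h₁ : IsLetterLinear (V := TruncatedHochschild 𝒜) (B := TruncatedHochschild 𝒜) K fun l =>
      evalWord (V := TruncatedHochschild 𝒜) (B := TruncatedHochschild 𝒜) (hochMaps 𝒜 π)
        (l.map Prod.snd) := fun l₁ l₂ k => by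
    simp only [List.map_append, List.map_cons]
    exact evalWord_hochMaps_isMultilinear π _ _
  have h₂ := h₁.mem_of_homogeneous (hochGrading 𝒜 (∑ i, k i + superDeg π))
    (List.ofFn fun i => (k i, a i)) (fun b hb => by
      obtain ⟨i, rfl⟩ := List.mem_ofFn.1 hb
      exact ha i) fun cs hcs => by
    have hlen : cs.length = π.sum := by simpa using congrArg List.length hcs
    have hsum := sum_fst_letter cs
    rw [hcs] at hsum
    have e : ((List.ofFn fun i => (k i, a i)).map Prod.fst).sum = ∑ i, k i := by
      rw [List.map_ofFn, List.sum_ofFn]; rfl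
    have h := structureMap_mem π cs hlen
    rw [← evalWord_hochMaps π cs hlen, ← hsum, e] at h
    simpa [Function.comp_def, letter] using h
  have h₃ : (List.ofFn fun i => (k i, a i)).map Prod.snd = List.ofFn a := by
    rw [List.map_ofFn]; rfl
  simpa only [h₃, evalWord_ofFn] using h₂

end Main

end GInfinity

end

open GInfinity in
theorem mainTheorem8 {K A : Type*} [Field K] [NonUnitalRing A] [Module K A] [IsScalarTower K A A]
    [SMulCommClass K A A] (𝒜 : ℤ → Submodule K A) [DirectSum.Decomposition 𝒜]
    [SetLike.GradedMul 𝒜] :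
    GInfinity.IsGInfinityAlgebra (K := K) (V := GInfinity.TruncatedHochschild 𝒜) (GInfinity.hochGrading 𝒜) (GInfinity.hochMaps 𝒜) := by
  refine ⟨hochGrading_isInternal, fun v => ?_, fun v => ?_, fun π h₀ h₁ h₂ => ?_,
    superDeg, fun π _ => ?_, fun π k a _ ha => hochMaps_mem π k a ha, fun L hL hu ha hm => ?_⟩
  · refine eq_self_of_emb (f := fun v => (hochMaps 𝒜).apply [[v], []]) ?_ (fun c =>
      hochMaps_apply_single rfl rfl) v
    simp only [PartitionedMaps.apply_eq]
    exact evalWord_hochMaps_isMultilinear [1, 0] [] []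
  · refine eq_self_of_emb (f := fun v => (hochMaps 𝒜).apply [[], [v]]) ?_ (fun c =>
      hochMaps_apply_single rfl rfl) v
    simp only [PartitionedMaps.apply_eq]
    exact evalWord_hochMaps_isMultilinear [0, 1] [] []
  · refine hochMaps_eq_zero fun cs => ?_
    unfold structureMap
    split <;> simp_all
  · rw [Int.modEq_iff_dvd, superDeg]
    -- The required parity is that of `sum + length - 1`, and subtracting `3 - length - sum` leaves
    -- twice this number.
    exact ⟨π.sum + π.length - 2, by ring⟩
  -- Types with three or more slots, and types `(k|n)` with `k ≥ 2`, have zero structure map and are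
  -- excluded by `hm`. The identity for one slot holds for every length.
  · rcases L with _ | ⟨u, _ | ⟨v, _ | ⟨w, L⟩⟩⟩
    · exact absurd rfl hL
    · exact (hochMaps 𝒜).master_single_of_letter superDeg (fun cs hcs => by
        rw [composition_single_letter hcs, PartitionedMaps.intertwine_single, add_zero])
        (hu u (by simp)) (ha u (by simp))
    · rcases u with _ | ⟨x, _ | ⟨y, u⟩⟩
      · exact absurd rfl (hu [] (by simp))
      · exact (hochMaps 𝒜).master_pair_of_letter superDeg
          (fun c cs hcs => composition_pair_letter c hcs) (hu v (by simp))
          (ha [x] (by simp) x (by simp)) (ha v (by simp))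
      · exact absurd (hochMaps_eq_zero fun cs => by simp [structureMap]) hm
    · exact absurd (hochMaps_eq_zero fun cs => by simp [structureMap]) hm
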